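/- Fix $N\in\mathbb N$ and $p\in\{0\}\cup[1,\infty)$, and let $\lambda^N$ be Lebesgue measure on $(0,1)^N$. Let $L_p=L_p(\lambda^N;\mathbb R^N)$ be the space of $\lambda^N$-a.e. classes of measurable maps $f:(0,1)^N\to\mathbb R^N$, required to be $p$-integrable if $p\ge 1$, with the metric $\|f-g\|_p$, where $\|f\|_p=\big(\int\sum_{k}|f_k|^p\,d\lambda^N\big)^{1/p}$ for $p\ge1$ and $\|f\|_0=\int |f|\wedge 1\,d\lambda^N$. Let $\mathcal P_p(\mathbb R^N)$ be the set of Borel probabilities on $\mathbb R^N$ with finite $p$-th moment (all Borel probabilities if $p=0$). A map $T=(T_k)_{k=1}^N:(0,1)^N\to\mathbb R^N$ is *triangular* if $T_k(u)=T_k(u_1,\dots,u_k)$ depends only on the first $k$ variables. A triangular $T$ is *increasing* if $T_k(u_1,\dots,u_{k-1},u_k)\le T_k(u_1,\dots,u_{k-1},u_k')$ whenever $u_k\le u_k'$; it is *strictly increasing* if $T_k(u_1,\dots,u_k)<T_k(u_1,\dots,u_k')$ whenever $u_k<u_k'$; and it is a *quantile process* if it is increasing and, for all $k\le m\le N$ and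 $u_k\le u_k'$, the equality $T_k(u_1,\dots,u_k)=T_k(u_1,\dots,u_k')$ implies $T_m(u_1,\dots,u_k,\dots,u_m)=T_m(u_1,\dots,u_k',\dots,u_m)$. Let $L_p^{\rm IT}$, $L_p^{\rm SIT}$, $L_p^{\rm quantile}\subseteq L_p$ be the sets of classes of measurable increasing triangular maps, strictly increasing triangular maps, and quantile processes, respectively. Call $\mu\in\mathcal P_p(\mathbb R^N)$ *triangular regular* if, for every $k\le N$ and $\mu$-almost every $x$, the conditional law under $\mu$ of the $k$-th coordinate given that the first $k-1$ coordinates are $x_1,\dots,x_{k-1}$ has no atoms. **Theorem.** For every $\mu\in\mathcal P_p(\mathbb R^N)$ there is exactly one $Q^\mu\in L_p^{\rm quantile}$ with law $Q^\mu_\#\lambda^N=\mu$. With $\mathrm{kr}_{\mu,\nu}=(Q^\mu,Q^\nu)_\#\lambda^N$, let $\mathcal{KR}_p(\mu,\nu)=\big(\int \sum_k|x_k-y_k|^p\,d\mathrm{kr}_{\mu,\nu}(x,y)\big)^{1/p}$ if $p\ge1$ and $\mathcal{KR}_0(\mu,\nu)=\int |x-y|\wedge1\,d\mathrm{kr}_{\mu,\nu}(x,y)$,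 so that $\mathcal{KR}_p(\mu,\nu)=\|Q^\mu-Q^\nu\|_p$. Then: 1. $L_p^{\rm SIT}\subseteq L_p^{\rm quantile}\subseteq L_p^{\rm IT}$, and these three sets are convex cones (closed under addition and under multiplication by positive scalars). 2. The $\|\cdot\|_p$-closure of $L_p^{\rm quantile}$ is exactly $L_p^{\rm IT}$. The map $\mu\mapsto Q^\mu$ extends to an isometry of the completion of $(\mathcal P_p(\mathbb R^N),\mathcal{KR}_p)$ onto $L_p^{\rm IT}$. 3. $\mu\in\mathcal P_p(\mathbb R^N)$ is triangular regular if and only if $Q^\mu\in L_p^{\rm SIT}$. Moreover $\{Q^\mu:\mu\in\mathcal P_p(\mathbb R^N)\text{ triangular regular}\}=L_p^{\rm SIT}$, and on $L_p^{\rm SIT}$ the map $Q\mapsto Q_\#\lambda^N$ is the inverse of $\mu\mapsto Q^\mu$. 4. $L_p^{\rm SIT}$ is a dense subset of $L_p^{\rm quantile}$. -/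

import Mathlib

open MeasureTheory ProbabilityTheory
open scoped NNReal ENNReal

namespace KnotheRosenblatt

noncomputable section

/-- The cube `(0,1)^N`. Its `volume` is the product `λ^N` of the Lebesgue measures on `(0,1)`. -/
abbrev Cube (N : ℕ) : Type := Fin N → Set.Ioo (0 : ℝ) 1

instance measureSpace_Ioo : MeasureSpace (Set.Ioo (0 : ℝ) 1) := Measure.Subtype.measureSpace

instance isProbabilityMeasure_Ioo :
    IsProbabilityMeasure (volume : Measure (Set.Ioo (0 : ℝ) 1)) where
  measure_univ := by
    rw [Measure.Subtype.volume_univ measurableSet_Ioo.nullMeasurableSet, Real.volume_Ioo]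
    simp

/-! ### The spaces `L_p(λ^N; ℝ^N)`, where `p = 0` or `1 ≤ p < ∞` -/

/-- The `p`-size of an `ℝ^N`-valued function: `∫ |g| ∧ 1` (with the Euclidean norm) if `p = 0`, and
`(∫ |g|_p ^ p) ^ (1 / p)` with `|x|_p ^ p = ∑ k, |x k| ^ p` otherwise. -/
def pSize {N : ℕ} {α : Type*} [MeasurableSpace α] (p : ℝ≥0) (ρ : Measure α)
    (g : α → Fin N → ℝ) : ℝ :=
  if p = 0 then ∫ a, min ‖WithLp.toLp 2 (g a)‖ 1 ∂ρ
  else (∫ a, ∑ k, |g a k| ^ (p : ℝ) ∂ρ) ^ (1 / (p : ℝ))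

/-- `L_p(λ^N; ℝ^N)` as a space of almost-everywhere classes: the `p`-integrable ones if `1 ≤ p`,
and all measurable ones if `p = 0` (`MemLp f 0` only says that `f` is a.e. strongly measurable). -/
def LpCube (N : ℕ) (p : ℝ≥0) : Submodule ℝ (Cube N →ₘ[volume] (Fin N → ℝ)) where
  carrier := {f | MemLp f (p : ℝ≥0∞) volume}
  zero_mem' := (memLp_congr_ae AEEqFun.coeFn_zero).2 MemLp.zero
  add_mem' {f g} hf hg := (memLp_congr_ae (AEEqFun.coeFn_add f g)).2 (MemLp.add hf hg)
  smul_mem' c f hf := (memLp_congr_ae (AEEqFun.coeFn_smul c f)).2 (MemLp.const_smul hf c)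

section Metric

variable {N : ℕ} {p : ℝ≥0}

theorem pSize_map {α β : Type*} [MeasurableSpace α] [MeasurableSpace β] (ρ : Measure α)
    (φ : α → β) (hφ : AEMeasurable φ ρ) (g : β → Fin N → ℝ) (hg : Measurable g) :
    pSize p (ρ.map φ) g = pSize p ρ (fun a => g (φ a)) := by
  unfold pSize
  split_ifs
  · rw [integral_map hφ]
    exact Measurable.aestronglyMeasurable (by fun_prop)
  · rw [integral_map hφ]
    exact Measurable.aestronglyMeasurable (by fun_prop)

theorem pSize_congr {α : Type*} [MeasurableSpace α] {ρ : Measure α} {f g : α → Fin N → ℝ}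
    (h : f =ᵐ[ρ] g) : pSize p ρ f = pSize p ρ g := by
  unfold pSize
  split_ifs
  · exact integral_congr_ae (h.mono fun a ha => by simp only [ha])
  · congr 1
    exact integral_congr_ae (h.mono fun a ha => by simp only [ha])

theorem pSize_zero (ρ : Measure (Cube N)) : pSize p ρ (fun _ => (0 : Fin N → ℝ)) = 0 := by
  unfold pSize
  split_ifs with h
  · simp
  · have : (p : ℝ) ≠ 0 := by exact_mod_cast h
    simp [Real.zero_rpow this, Real.zero_rpow (inv_ne_zero this)]

theorem pSize_neg {α : Type*} [MeasurableSpace α] (ρ : Measure α) (g : α → Fin N → ℝ) :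
    pSize p ρ (fun a => - g a) = pSize p ρ g := by
  unfold pSize
  simp

theorem aestronglyMeasurable_toLp {α : Type*} [MeasurableSpace α] {ρ : Measure α}
    {g : α → Fin N → ℝ} (hg : AEStronglyMeasurable g ρ) (q : ℝ≥0∞) [Fact (1 ≤ q)] :
    AEStronglyMeasurable (fun a => WithLp.toLp q (g a)) ρ :=
  (PiLp.continuous_toLp q (fun _ : Fin N => ℝ)).comp_aestronglyMeasurable hg

theorem memLp_toLp {α : Type*} [MeasurableSpace α] {ρ : Measure α}
    {g : α → Fin N → ℝ} {q : ℝ≥0∞} [Fact (1 ≤ q)] (hg : MemLp g q ρ) :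
    MemLp (fun a => WithLp.toLp q (g a)) q ρ :=
  ((PiLp.continuousLinearEquiv q ℝ (fun _ : Fin N => ℝ)).symm.toContinuousLinearMap).comp_memLp' hg

theorem pSize_eq_eLpNorm {α : Type*} [MeasurableSpace α] {ρ : Measure α}
    {g : α → Fin N → ℝ} (hp : 1 ≤ p) [Fact (1 ≤ (p : ℝ≥0∞))] (hg : MemLp g p ρ) :
    pSize p ρ g = (eLpNorm (fun a => WithLp.toLp (p : ℝ≥0∞) (g a)) p ρ).toReal := by
  have h0 : p ≠ 0 := (zero_lt_one.trans_le hp).ne'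
  have h0' : (p : ℝ) ≠ 0 := by exact_mod_cast h0
  rw [(memLp_toLp hg).eLpNorm_eq_integral_rpow_norm (by exact_mod_cast h0) ENNReal.coe_ne_top,
    ENNReal.toReal_ofReal (by positivity)]
  simp only [pSize, if_neg h0, ENNReal.coe_toReal, one_div]
  congr 1
  refine integral_congr_ae (Filter.Eventually.of_forall fun a => ?_)
  have hs : 0 ≤ ∑ k, |g a k| ^ (p : ℝ) := Finset.sum_nonneg fun _ _ => by positivity
  simp only
  rw [PiLp.norm_eq_sum (by simpa using (zero_lt_one.trans_le hp))]
  simp only [ENNReal.coe_toReal, Real.norm_eq_abs]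
  rw [← Real.rpow_mul hs, one_div, inv_mul_cancel₀ h0', Real.rpow_one]

theorem pSize_add_le {f g : Cube N → Fin N → ℝ} (hp : p = 0 ∨ 1 ≤ p)
    (hf : MemLp f p volume) (hg : MemLp g p volume) :
    pSize p volume (fun a => f a + g a) ≤ pSize p volume f + pSize p volume g := by
  rcases hp with rfl | hp
  · have key : ∀ h : Cube N → Fin N → ℝ, AEStronglyMeasurable h volume →
        Integrable (fun a => min ‖WithLp.toLp 2 (h a)‖ (1 : ℝ)) volume := by
      intro h hh
      refine Integrable.of_bound (C := 1) ?_ (Filter.Eventually.of_forall fun a => ?_)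
      · exact (aestronglyMeasurable_toLp hh 2).norm.inf aestronglyMeasurable_const
      · rw [Real.norm_of_nonneg (le_min (norm_nonneg _) zero_le_one)]
        exact min_le_right _ _
    simp only [pSize, if_true]
    rw [← integral_add (key _ hf.1) (key _ hg.1)]
    refine integral_mono (key _ (hf.1.add hg.1)) ((key _ hf.1).add (key _ hg.1)) fun a => ?_
    have h1 := norm_add_le (WithLp.toLp 2 (f a)) (WithLp.toLp 2 (g a))
    have h2 := norm_nonneg (WithLp.toLp 2 (f a))
    have h3 := norm_nonneg (WithLp.toLp 2 (g a))
    simp only [WithLp.toLp_add]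
    rcases le_total ‖WithLp.toLp 2 (f a)‖ 1 with h4 | h4 <;>
    rcases le_total ‖WithLp.toLp 2 (g a)‖ 1 with h5 | h5 <;>
    simp only [min_eq_left, min_eq_right, h4, h5] <;>
    first
      | exact (min_le_left _ _).trans h1
      | exact (min_le_right _ _).trans (by linarith)
  · have : Fact (1 ≤ (p : ℝ≥0∞)) := ⟨by exact_mod_cast hp⟩
    have hfg : MemLp (fun a => f a + g a) p volume := hf.add hg
    rw [pSize_eq_eLpNorm hp hf, pSize_eq_eLpNorm hp hg, pSize_eq_eLpNorm hp hfg,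
      ← ENNReal.toReal_add (memLp_toLp hf).2.ne (memLp_toLp hg).2.ne]
    refine ENNReal.toReal_mono
      (ENNReal.add_ne_top.2 ⟨(memLp_toLp hf).2.ne, (memLp_toLp hg).2.ne⟩) ?_
    exact eLpNorm_add_le (memLp_toLp hf).1 (memLp_toLp hg).1 (by exact_mod_cast hp)

theorem ae_eq_zero_of_pSize {f : Cube N → Fin N → ℝ} (hp : p = 0 ∨ 1 ≤ p)
    (hf : MemLp f p volume) (h : pSize p volume f = 0) : f =ᵐ[volume] 0 := by
  rcases hp with rfl | hp
  · simp only [pSize, if_true] at h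
    rw [integral_eq_zero_iff_of_nonneg (fun a => le_min (norm_nonneg _) zero_le_one)] at h
    · filter_upwards [h] with a ha
      have ha' : min ‖WithLp.toLp 2 (f a)‖ (1 : ℝ) = 0 := ha
      rcases min_choice ‖WithLp.toLp 2 (f a)‖ (1 : ℝ) with h1 | h1
      · rw [h1, norm_eq_zero] at ha'
        simpa using ha'
      · rw [h1] at ha'
        exact absurd ha' one_ne_zero
    · refine Integrable.of_bound (C := 1) ?_ (Filter.Eventually.of_forall fun a => ?_)
      · exact (aestronglyMeasurable_toLp hf.1 2).norm.inf aestronglyMeasurable_const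
      · rw [Real.norm_of_nonneg (le_min (norm_nonneg _) zero_le_one)]
        exact min_le_right _ _
  · have : Fact (1 ≤ (p : ℝ≥0∞)) := ⟨by exact_mod_cast hp⟩
    have h0 : p ≠ 0 := (zero_lt_one.trans_le hp).ne'
    rw [pSize_eq_eLpNorm hp hf, ENNReal.toReal_eq_zero_iff] at h
    have h' := h.resolve_right (memLp_toLp hf).2.ne
    rw [eLpNorm_eq_zero_iff (memLp_toLp hf).1 (by exact_mod_cast h0)] at h'
    filter_upwards [h'] with a ha
    simpa using ha

theorem coeFn_sub_LpCube (f g : LpCube N p) :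
    ((f - g : LpCube N p) : Cube N →ₘ[volume] (Fin N → ℝ)) =ᵐ[volume]
      fun u => (f : Cube N →ₘ[volume] (Fin N → ℝ)) u - (g : Cube N →ₘ[volume] (Fin N → ℝ)) u :=
  AEEqFun.coeFn_sub _ _

/-- The metric `‖f - g‖_p` of `L_p(λ^N; ℝ^N)`. -/
instance [hp : Fact (p = 0 ∨ 1 ≤ p)] : MetricSpace (LpCube N p) where
  dist f g := pSize p volume (fun u =>
    (f : Cube N →ₘ[volume] (Fin N → ℝ)) u - (g : Cube N →ₘ[volume] (Fin N → ℝ)) u)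
  dist_self f := by simpa using pSize_zero (N := N) (p := p) volume
  dist_comm f g := by
    rw [← pSize_neg]
    simp
  dist_triangle f g h := by
    have := pSize_add_le hp.out
      ((memLp_congr_ae (coeFn_sub_LpCube f g)).1 (f - g).2)
      ((memLp_congr_ae (coeFn_sub_LpCube g h)).1 (g - h).2)
    simpa using this
  eq_of_dist_eq_zero {f g} h := by
    have := ae_eq_zero_of_pSize hp.out
      ((memLp_congr_ae (coeFn_sub_LpCube f g)).1 (f - g).2) h
    refine Subtype.ext (AEEqFun.ext ?_)
    filter_upwards [this] with u hu
    exact sub_eq_zero.1 hu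

end Metric

/-! ### Triangular transformations and quantile processes -/

/-- `T_k` depends only on the first `k` variables. -/
def IsTriangular {N : ℕ} (T : Cube N → Fin N → ℝ) : Prop :=
  ∀ (k : Fin N) (u v : Cube N), (∀ i ≤ k, u i = v i) → T u k = T v k

/-- Condition (inc): `T_k(u_1, …, u_k) ≤ T_k(u_1, …, u_k')` whenever `u_k ≤ u_k'`. -/
def IsIncreasing {N : ℕ} (T : Cube N → Fin N → ℝ) : Prop :=
  ∀ (k : Fin N) (u : Cube N) (s : Set.Ioo (0 : ℝ) 1), u k ≤ s →
    T u k ≤ T (Function.update u k s) k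

/-- Condition (sinc): `T_k(u_1, …, u_k) < T_k(u_1, …, u_k')` whenever `u_k < u_k'`. -/
def IsStrictlyIncreasing {N : ℕ} (T : Cube N → Fin N → ℝ) : Prop :=
  ∀ (k : Fin N) (u : Cube N) (s : Set.Ioo (0 : ℝ) 1), u k < s →
    T u k < T (Function.update u k s) k

/-- Condition (con): if `u_k ≤ u_k'` and `T_k(u_1, …, u_k) = T_k(u_1, …, u_k')`, then for all
`m ≥ k` also `T_m(u_1, …, u_k, …, u_m) = T_m(u_1, …, u_k', …, u_m)`. -/
def IsConsistent {N : ℕ} (T : Cube N → Fin N → ℝ) : Prop :=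
  ∀ (k m : Fin N), k ≤ m → ∀ (u : Cube N) (s : Set.Ioo (0 : ℝ) 1), u k ≤ s →
    T u k = T (Function.update u k s) k → T u m = T (Function.update u k s) m

/-- `L_p^IT`: the classes in `L_p` of increasing triangular transformations. -/
def IT (N : ℕ) (p : ℝ≥0) : Set (LpCube N p) :=
  {f | ∃ T : Cube N → Fin N → ℝ, Measurable T ∧ IsTriangular T ∧ IsIncreasing T ∧
    (f : Cube N →ₘ[volume] (Fin N → ℝ)) =ᵐ[volume] T}

/-- `L_p^SIT`: the classes in `L_p` of strictly increasing triangular transformations. -/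
def SIT (N : ℕ) (p : ℝ≥0) : Set (LpCube N p) :=
  {f | ∃ T : Cube N → Fin N → ℝ, Measurable T ∧ IsTriangular T ∧ IsStrictlyIncreasing T ∧
    (f : Cube N →ₘ[volume] (Fin N → ℝ)) =ᵐ[volume] T}

/-- `L_p^quantile`: the classes in `L_p` of quantile processes. -/
def quantileSet (N : ℕ) (p : ℝ≥0) : Set (LpCube N p) :=
  {f | ∃ T : Cube N → Fin N → ℝ, Measurable T ∧ IsTriangular T ∧ IsIncreasing T ∧
    IsConsistent T ∧ (f : Cube N →ₘ[volume] (Fin N → ℝ)) =ᵐ[volume] T}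

/-! ### Probabilities on `ℝ^N` and the Knothe--Rosenblatt distance -/

/-- `P_p(ℝ^N)`: the Borel probabilities on `ℝ^N` with finite `p`-th moment (all of them if
`p = 0`). -/
@[ext] structure Prob (N : ℕ) (p : ℝ≥0) where
  meas : Measure (Fin N → ℝ)
  isProb : IsProbabilityMeasure meas
  memLp : MemLp (fun x : Fin N → ℝ => x) (p : ℝ≥0∞) meas

/-- `μ` is triangular regular: for every `k` and `μ`-almost every `x`, the conditional law of the
`k`-th coordinate given that the previous ones are those of `x` has no atoms. -/
def TriangularRegular {N : ℕ} {p : ℝ≥0} (μ : Prob N p) : Prop :=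
  haveI := μ.isProb
  ∀ k : Fin N, ∀ᵐ x ∂μ.meas, ∀ t : ℝ,
    condDistrib (fun y : Fin N → ℝ => y k)
      (fun (y : Fin N → ℝ) (i : Fin k) => y (Fin.castLE k.is_lt.le i)) μ.meas
      (fun i : Fin k => x (Fin.castLE k.is_lt.le i)) {t} = 0

section

variable {N : ℕ} {p : ℝ≥0}

/-- The law `f_# λ^N` of `f ∈ L_p(λ^N; ℝ^N)`. -/
def law (f : LpCube N p) : Prob N p where
  meas := (volume : Measure (Cube N)).map (f : Cube N →ₘ[volume] (Fin N → ℝ))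
  isProb := Measure.isProbabilityMeasure_map
    (f : Cube N →ₘ[volume] (Fin N → ℝ)).aestronglyMeasurable.aemeasurable
  memLp := (memLp_map_measure_iff aestronglyMeasurable_id
    (f : Cube N →ₘ[volume] (Fin N → ℝ)).aestronglyMeasurable.aemeasurable).2 f.2

open Classical in
/-- The quantile process `Q^μ` of `μ ∈ P_p(ℝ^N)`: the a.s. unique quantile process with law `μ`. -/
def Q (μ : Prob N p) : LpCube N p :=
  if h : ∃ f ∈ quantileSet N p, law f = μ then h.choose else 0

/-- The Knothe--Rosenblatt coupling `(Q^μ, Q^ν)_# λ^N`. -/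
def krCoupling (μ ν : Prob N p) : Measure ((Fin N → ℝ) × (Fin N → ℝ)) :=
  (volume : Measure (Cube N)).map fun u =>
    ((Q μ : Cube N →ₘ[volume] (Fin N → ℝ)) u, (Q ν : Cube N →ₘ[volume] (Fin N → ℝ)) u)

/-- The Knothe--Rosenblatt distance `KR_p`: the `p`-size of `x - y` under the
Knothe--Rosenblatt coupling of `μ` and `ν`. -/
def krDist (μ ν : Prob N p) : ℝ :=
  pSize p (krCoupling μ ν) fun z => z.1 - z.2

theorem krDist_eq_dist [Fact (p = 0 ∨ 1 ≤ p)] (μ ν : Prob N p) :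
    krDist μ ν = dist (Q μ) (Q ν) :=
  pSize_map _ _
    ((Q μ : Cube N →ₘ[volume] (Fin N → ℝ)).aestronglyMeasurable.aemeasurable.prodMk
      (Q ν : Cube N →ₘ[volume] (Fin N → ℝ)).aestronglyMeasurable.aemeasurable) _ (by fun_prop)

/-- `P_p(ℝ^N)` with the Knothe--Rosenblatt distance. -/
instance [Fact (p = 0 ∨ 1 ≤ p)] : PseudoMetricSpace (Prob N p) where
  dist := krDist
  dist_self μ := by rw [krDist_eq_dist, dist_self]
  dist_comm μ ν := by rw [krDist_eq_dist, krDist_eq_dist, dist_comm]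
  dist_triangle μ ν ρ := by
    simp only [krDist_eq_dist]
    exact dist_triangle _ _ _

end

end

end KnotheRosenblatt

open KnotheRosenblatt

open Filter Topology

namespace KnotheRosenblatt

section

variable {N : ℕ} {p : ℝ≥0}

/-! ### Measures and monotone functions on the line -/

/-! Everything rests on two facts about monotone functions on `(0,1)`: such a function is determined
almost everywhere by its law (`ae_eq_of_monotone_of_map_eq`), and it is strictly increasing exactly
when its law has no atoms (`strictMono_iff_map_singleton`). Both are applied fibrewise, to `T_k` as
a function of its own variable `u_k`.

The consistency condition says that `T_k` sees `u_1, …, u_{k-1}` only through the values `T_1, …,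
T_{k-1}` (`IsConsistent.apply_eq`). Hence the law of `T_k` along a fibre is a function of these
values, and Fubini identifies it with the conditional law of the `k`-th coordinate under the law of
`T` (`condLaw_ae_eq_fiberLaw`). Uniqueness of the quantile process follows by induction on `k`.
Existence comes from iterating conditional quantile functions (`map_quantileProcess`). So `Q` is an
isometric bijection onto the quantile processes, and triangular regularity of `μ` becomes strict
monotonicity of almost every fibre of `Q μ`.

For the closure, a limit of increasing triangular maps is an almost everywhere limit along a
subsequence, and an upper limit gives a representative that is increasing and triangular everywhere
(`isClosed_IT`). Conversely, adding a small multiple of the identity makes an increasing map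
strictly increasing, hence a quantile process (`IT_subset_closure_SIT`). Since `L_p` is complete,
the completion of the laws is this closure (`range_extension_Q`). -/

theorem measure_ext_of_Iic_rat {μ ν : Measure ℝ} [IsProbabilityMeasure μ] [IsProbabilityMeasure ν]
    (h : ∀ q : ℚ, μ (Set.Iic (q : ℝ)) = ν (Set.Iic (q : ℝ))) : μ = ν := by
  refine ext_of_generate_finite _
    ((BorelSpace.measurable_eq (α := ℝ)).trans Real.borel_eq_generateFrom_Iic_rat)
    Real.isPiSystem_Iic_rat ?_ ?_
  · rintro s hs
    simp only [Set.mem_iUnion, Set.mem_singleton_iff] at hs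
    obtain ⟨q, rfl⟩ := hs
    exact h q
  · simp

/-- The sublevel sets of `f` and `g` at a common height are lower sets of a linear order, hence
nested. They have the same finite measure, so they differ by a null set; rational heights suffice.
-/
theorem ae_le_of_monotone_of_map_eq {α : Type*} [MeasurableSpace α] [LinearOrder α]
    {ρ : Measure α} [IsFiniteMeasure ρ] {f g : α → ℝ} (hf : Monotone f) (hg : Monotone g)
    (hfm : Measurable f) (hgm : Measurable g) (h : ρ.map f = ρ.map g) : ∀ᵐ a ∂ρ, f a ≤ g a := by
  have key : ∀ q : ℚ, ∀ᵐ a ∂ρ, ¬ (g a ≤ q ∧ ¬ f a ≤ q) := by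
    intro q
    set A : Set α := f ⁻¹' Set.Iic (q : ℝ)
    set B : Set α := g ⁻¹' Set.Iic (q : ℝ)
    have hA : IsLowerSet A := (isLowerSet_Iic _).preimage hf
    have hB : IsLowerSet B := (isLowerSet_Iic _).preimage hg
    have hAm : MeasurableSet A := hfm measurableSet_Iic
    have hBm : MeasurableSet B := hgm measurableSet_Iic
    have hAB : ρ A = ρ B := by
      rw [← Measure.map_apply hfm measurableSet_Iic, h, Measure.map_apply hgm measurableSet_Iic]
    have h0 : ρ (B \ A) = 0 := by
      rcases hA.total hB with h1 | h1
      · rw [measure_sdiff h1 hAm.nullMeasurableSet (measure_ne_top _ _), hAB, tsub_self]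
      · rw [Set.sdiff_eq_empty.2 h1, measure_empty]
    rw [ae_iff]
    convert h0 using 2
    ext a
    simp [A, B]
  rw [← ae_all_iff] at key
  filter_upwards [key] with a ha
  by_contra! hlt
  obtain ⟨q, h1, h2⟩ := exists_rat_btwn hlt
  exact ha q ⟨h1.le, not_le.2 h2⟩

theorem ae_eq_of_monotone_of_map_eq {α : Type*} [MeasurableSpace α] [LinearOrder α]
    {ρ : Measure α} [IsFiniteMeasure ρ] {f g : α → ℝ} (hf : Monotone f) (hg : Monotone g)
    (hfm : Measurable f) (hgm : Measurable g) (h : ρ.map f = ρ.map g) : f =ᵐ[ρ] g := by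
  filter_upwards [ae_le_of_monotone_of_map_eq hf hg hfm hgm h,
    ae_le_of_monotone_of_map_eq hg hf hgm hfm h.symm] with a h1 h2 using le_antisymm h1 h2

/-- A measurable function on a standard Borel space that is constant on the fibres of a measurable
map into a standard Borel space factors measurably through it. -/
theorem exists_measurable_factor {X Z β : Type*} [MeasurableSpace X] [StandardBorelSpace X]
    [MeasurableSpace Z] [StandardBorelSpace Z] [MeasurableSpace β] [StandardBorelSpace β]
    [Nonempty β] {f : X → Z} {g : X → β} (hf : Measurable f) (hg : Measurable g)
    (hfg : Function.FactorsThrough g f) : ∃ h : Z → β, Measurable h ∧ g = h ∘ f := by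
  obtain ⟨b⟩ := ‹Nonempty β›
  set e : Z → β := Function.extend f g fun _ => b
  have he : e ∘ f = g := hfg.extend_comp _
  -- Standard Borel structure enters here, through Lusin separation: a subset of the range of `f`
  -- with measurable preimage is measurable in the range. The range itself need not be measurable,
  -- so `e` need not be; the last line therefore takes a measurable factor from the pulled back
  -- σ-algebra instead.
  have hr : Measurable ((Set.range f).domRestrict e) :=
    hf.measurable_comp_iff_restrict.1 (he ▸ hg)
  have hg' : Measurable[MeasurableSpace.comap f inferInstance] g := by
    have h1 : Measurable[MeasurableSpace.comap f inferInstance]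
        (fun x => (⟨f x, Set.mem_range_self x⟩ : Set.range f)) :=
      (comap_measurable f).subtype_mk
    have h2 : g = (Set.range f).domRestrict e ∘
        (fun x => (⟨f x, Set.mem_range_self x⟩ : Set.range f)) := by
      rw [← he]; rfl
    rw [h2]
    exact hr.comp h1
  exact hg'.exists_eq_measurable_comp

instance standardBorelSpace_Ioo : StandardBorelSpace (Set.Ioo (0 : ℝ) 1) :=
  measurableSet_Ioo.standardBorel

/-! ### Changing one coordinate -/

theorem measurable_update_pair (k : Fin N) :
    Measurable fun z : Cube N × Set.Ioo (0 : ℝ) 1 => Function.update z.1 k z.2 := by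
  refine measurable_pi_iff.2 fun i => ?_
  by_cases h : i = k
  · subst h; simpa using measurable_snd
  · simp only [Function.update_of_ne h]
    exact (measurable_pi_apply i).comp measurable_fst

/-- Replacing one coordinate by an independent uniform variable preserves the law of the point. This
is the form of Fubini used throughout: it frees the `k`-th variable without splitting the cube into
a product. -/
theorem measurePreserving_update (k : Fin N) :
    MeasurePreserving (fun z : Cube N × Set.Ioo (0 : ℝ) 1 => Function.update z.1 k z.2)
      (volume.prod volume) volume := by
  refine ⟨measurable_update_pair k, ?_⟩
  symm
  refine Measure.pi_eq fun s hs => ?_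
  rw [Measure.map_apply (measurable_update_pair k) (MeasurableSet.univ_pi hs)]
  have : (fun z : Cube N × Set.Ioo (0 : ℝ) 1 => Function.update z.1 k z.2) ⁻¹' Set.univ.pi s =
      Set.univ.pi (Function.update s k Set.univ) ×ˢ s k := by
    ext ⟨u, r⟩
    simp only [Set.mem_preimage, Set.mem_univ_pi, Set.mem_prod]
    constructor
    · intro h
      refine ⟨fun i => ?_, by simpa using h k⟩
      by_cases hi : i = k
      · subst hi; simp
      · simpa [hi] using h i
    · rintro ⟨h1, h2⟩ i
      by_cases hi : i = k
      · subst hi; simpa using h2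
      · simpa [hi] using h1 i
  rw [this, Measure.prod_prod, volume_pi, Measure.pi_pi,
    ← Finset.mul_prod_erase _ _ (Finset.mem_univ k),
    ← Finset.mul_prod_erase _ (fun i => volume (s i)) (Finset.mem_univ k)]
  simp only [Function.update_self, measure_univ, one_mul]
  rw [mul_comm]
  congr 1
  refine Finset.prod_congr rfl fun i hi => ?_
  rw [Function.update_of_ne (Finset.ne_of_mem_erase hi)]

/-- The first `k` coordinates. -/
def initial (k : Fin N) (x : Fin N → ℝ) (i : Fin k) : ℝ := x (Fin.castLE k.is_lt.le i)

theorem measurable_initial (k : Fin N) : Measurable (initial k) :=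
  measurable_pi_iff.2 fun _ => measurable_pi_apply _

theorem initial_eq_iff {k : Fin N} {x y : Fin N → ℝ} :
    initial k x = initial k y ↔ ∀ i < k, x i = y i := by
  constructor
  · intro h i hi
    exact congrFun h ⟨i, hi⟩
  · intro h
    exact funext fun i => h _ (by simp [Fin.lt_def])

section Triangular

variable {T : Cube N → Fin N → ℝ}

theorem IsTriangular.update (hT : IsTriangular T) {i k : Fin N} (h : i < k) (u : Cube N)
    (s : Set.Ioo (0 : ℝ) 1) : T (Function.update u k s) i = T u i :=
  hT _ _ _ fun _ hj => Function.update_of_ne (hj.trans_lt h).ne _ _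

theorem IsTriangular.initial_update (hT : IsTriangular T) (k : Fin N) (u : Cube N)
    (s : Set.Ioo (0 : ℝ) 1) : initial k (T (Function.update u k s)) = initial k (T u) :=
  initial_eq_iff.2 fun _ hi => hT.update hi u s

theorem IsIncreasing.monotone_update (hT : IsIncreasing T) (k : Fin N) (u : Cube N) :
    Monotone fun s => T (Function.update u k s) k := by
  intro s t hst
  simpa using hT k (Function.update u k s) t (by simpa using hst)

theorem IsStrictlyIncreasing.strictMono_update (hT : IsStrictlyIncreasing T) (k : Fin N)
    (u : Cube N) : StrictMono fun s => T (Function.update u k s) k := by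
  intro s t hst
  simpa using hT k (Function.update u k s) t (by simpa using hst)

theorem IsStrictlyIncreasing.isIncreasing (hT : IsStrictlyIncreasing T) : IsIncreasing T := by
  intro k u s hs
  simpa using (hT.strictMono_update k u).monotone hs

theorem IsStrictlyIncreasing.isConsistent (hT : IsStrictlyIncreasing T) : IsConsistent T := by
  intro k m _ u s _ h
  have : u k = s := (hT.strictMono_update k u).injective (by simpa using h)
  rw [← this, Function.update_eq_self]

theorem IsConsistent.apply_eq_update (hT : IsConsistent T) {k m : Fin N} (hkm : k ≤ m)
    (u : Cube N) (s : Set.Ioo (0 : ℝ) 1) (h : T u k = T (Function.update u k s) k) :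
    T u m = T (Function.update u k s) m := by
  rcases le_total (u k) s with hs | hs
  · exact hT k m hkm u s hs h
  · have := hT k m hkm (Function.update u k s) (u k) (by simpa using hs)
    simp only [Function.update_idem, Function.update_eq_self] at this
    exact (this h.symm).symm

/-- A component of a quantile process depends only on the values of the preceding components and
on its own variable. -/
theorem IsConsistent.apply_eq (hT : IsConsistent T) (htri : IsTriangular T) {k : Fin N}
    {u v : Cube N} (h : ∀ i < k, T u i = T v i) (hk : u k = v k) : T u k = T v k := by
  -- The hybrid point `w j` has its first `j` coordinates from `v` and the others from `u`. Passing
  -- from `w j` to `w (j + 1)` leaves component `j` unchanged, because `T u` and `T v` agree there,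
  -- so consistency leaves all later components unchanged too.
  let w : ℕ → Cube N := fun j i => if (i : ℕ) < j then v i else u i
  have key : ∀ j : ℕ, j ≤ k → ∀ m, T u m = T (w j) m := by
    intro j
    induction j with
    | zero => intro _ m; simp [w]
    | succ j ih =>
      intro hj m
      let j' : Fin N := ⟨j, by omega⟩
      have hw : w (j + 1) = Function.update (w j) j' (v j') := by
        funext i
        by_cases hi : i = j'
        · subst hi; simp [w, j']
        · have : (i : ℕ) ≠ j := fun h => hi (Fin.ext h)
          rw [Function.update_of_ne hi]
          simp only [w]
          congr 1
          exact propext ⟨fun _ => by omega, fun _ => by omega⟩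
      rw [ih (by omega) m]
      rcases lt_or_ge m j' with hm | hm
      · rw [hw, htri.update hm]
      · rw [hw]
        refine hT.apply_eq_update hm _ _ ?_
        rw [← hw, ← ih (by omega) j', h j' (Fin.lt_def.2 (by simp only [j']; omega))]
        refine htri _ _ _ fun i hi => ?_
        have : (i : ℕ) < j + 1 := Nat.lt_succ_of_le (Fin.le_def.1 hi)
        simp [w, this]
  rw [key k le_rfl k]
  refine htri _ _ _ fun i hi => ?_
  rcases hi.lt_or_eq with hi | rfl
  · simp [w, Fin.lt_def.1 hi]
  · simpa [w] using hk

end Triangular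

/-! ### Conditional laws of quantile processes -/

/-- The law of the `k`-th component of `T` as a function of its `k`-th variable alone. -/
noncomputable def fiberLaw (T : Cube N → Fin N → ℝ) (k : Fin N) (u : Cube N) : Measure ℝ :=
  (volume : Measure (Set.Ioo (0 : ℝ) 1)).map fun s => T (Function.update u k s) k

theorem measurable_fiber {T : Cube N → Fin N → ℝ} (hT : Measurable T) (k : Fin N) :
    Measurable fun z : Cube N × Set.Ioo (0 : ℝ) 1 => T (Function.update z.1 k z.2) k :=
  (measurable_pi_apply k).comp (hT.comp (measurable_update_pair k))

theorem measurable_fiber_apply {T : Cube N → Fin N → ℝ} (hT : Measurable T) (k : Fin N)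
    (u : Cube N) : Measurable fun s : Set.Ioo (0 : ℝ) 1 => T (Function.update u k s) k :=
  (measurable_fiber hT k).comp measurable_prodMk_left

/-- The conditional law of the `k`-th coordinate given the preceding ones. -/
noncomputable abbrev condLaw (μ : Measure (Fin N → ℝ)) [IsFiniteMeasure μ] (k : Fin N) :
    Kernel (Fin k → ℝ) ℝ :=
  condDistrib (fun y : Fin N → ℝ => y k) (initial k) μ

theorem compProd_condLaw (μ : Measure (Fin N → ℝ)) [IsFiniteMeasure μ] (k : Fin N) :
    μ.map (initial k) ⊗ₘ condLaw μ k = μ.map fun y => (initial k y, y k) :=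
  compProd_map_condDistrib (measurable_pi_apply k).aemeasurable

/-- Consistency makes the fibre law a function of the preceding values, and Fubini shows that this
function integrates as the conditional law must. It is therefore a version of that law; rational
half-lines reduce the comparison to countably many real functions. -/
theorem condLaw_ae_eq_fiberLaw {T : Cube N → Fin N → ℝ} (hT : Measurable T)
    (htri : IsTriangular T) (hcon : IsConsistent T) (μ : Measure (Fin N → ℝ))
    [IsProbabilityMeasure μ] (hμ : (volume : Measure (Cube N)).map T = μ) (k : Fin N) :
    ∀ᵐ u : Cube N, condLaw μ k (initial k (T u)) = fiberLaw T k u := by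
  set X : Cube N → Fin k → ℝ := fun u => initial k (T u)
  have hX : Measurable X := (measurable_initial k).comp hT
  have hlaw : ∀ u (q : ℝ), fiberLaw T k u (Set.Iic q) =
      volume {s : Set.Ioo (0 : ℝ) 1 | T (Function.update u k s) k ≤ q} := fun u q =>
    Measure.map_apply (measurable_fiber_apply hT k u) measurableSet_Iic
  have hmeas : ∀ q : ℝ, Measurable fun u => fiberLaw T k u (Set.Iic q) := by
    intro q
    simp only [hlaw]
    exact measurable_measure_prodMk_left
      (measurableSet_le (measurable_fiber hT k) measurable_const)
  have hae : ∀ q : ℚ, ∀ᵐ u : Cube N,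
      condLaw μ k (X u) (Set.Iic (q : ℝ)) = fiberLaw T k u (Set.Iic (q : ℝ)) := by
    intro q
    obtain ⟨h, hhm, hh⟩ := exists_measurable_factor hX (hmeas q) (by
      intro u v huv
      simp only [hlaw]
      congr 1
      ext s
      have : T (Function.update u k s) k = T (Function.update v k s) k := by
        refine hcon.apply_eq htri (fun i hi => ?_) (by simp)
        rw [htri.update hi, htri.update hi]
        exact initial_eq_iff.1 huv i hi
      simp only [Set.mem_ofPred_eq, this])
    have hmap : (volume : Measure (Cube N)).map X = μ.map (initial k) := by
      rw [← hμ, Measure.map_map (measurable_initial k) hT]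
      rfl
    have : (fun x => condLaw μ k x (Set.Iic (q : ℝ))) =ᵐ[volume.map X] h := by
      refine ae_eq_of_forall_setLIntegral_eq_of_sigmaFinite
        (Kernel.measurable_coe _ measurableSet_Iic) hhm fun A hA _ => ?_
      have e1 : ∫⁻ x in A, condLaw μ k x (Set.Iic (q : ℝ)) ∂(volume.map X) =
          volume {w : Cube N | X w ∈ A ∧ T w k ≤ q} := by
        have h2 := Measure.compProd_apply_prod (μ := μ.map (initial k)) (κ := condLaw μ k) hA
          (measurableSet_Iic (a := (q : ℝ)))
        rw [hmap, ← h2, compProd_condLaw, Measure.map_apply ((measurable_initial k).prodMk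
          (measurable_pi_apply k)) (hA.prod measurableSet_Iic), ← hμ, Measure.map_apply hT
          (((measurable_initial k).prodMk
          (measurable_pi_apply k)) (hA.prod measurableSet_Iic))]
        rfl
      have e2 : ∫⁻ x in A, h x ∂(volume.map X) =
          volume {w : Cube N | X w ∈ A ∧ T w k ≤ q} := by
        have hS : MeasurableSet {w : Cube N | X w ∈ A ∧ T w k ≤ q} :=
          (hX hA).inter (measurableSet_le ((measurable_pi_apply k).comp hT) measurable_const)
        rw [setLIntegral_map hA hhm hX, ← (measurePreserving_update k).measure_preimage
          hS.nullMeasurableSet, Measure.prod_apply ((measurable_update_pair k) hS),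
          ← lintegral_indicator (hX hA)]
        -- Resampling the `k`-th variable does not move `X`. The section over `u` is thus empty or a
        -- whole sublevel set of the fibre, according to whether `X u ∈ A`.
        refine lintegral_congr fun u => ?_
        have hu : h (X u) = fiberLaw T k u (Set.Iic (q : ℝ)) := (congrFun hh u).symm
        have hXu : ∀ s, X (Function.update u k s) = X u := fun s => htri.initial_update k u s
        by_cases huA : X u ∈ A
        · rw [Set.indicator_of_mem (by exact huA), hu, hlaw]
          congr 1
          ext s
          simp [hXu, huA]
        · rw [Set.indicator_of_notMem (by exact huA)]
          symm
          convert measure_empty (μ := (volume : Measure (Set.Ioo (0 : ℝ) 1)))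
          ext s
          simp [hXu, huA]
      rw [e1, e2]
    filter_upwards [ae_of_ae_map hX.aemeasurable this] with u hu
    rw [hu]
    exact (congrFun hh u).symm
  rw [← ae_all_iff] at hae
  filter_upwards [hae] with u hu
  have : IsProbabilityMeasure (fiberLaw T k u) :=
    Measure.isProbabilityMeasure_map (measurable_fiber_apply hT k u).aemeasurable
  exact measure_ext_of_Iic_rat hu

theorem ae_eq_of_fiberLaw_ae_eq {S T : Cube N → Fin N → ℝ} (hS : Measurable S) (hT : Measurable T)
    (hSi : IsIncreasing S) (hTi : IsIncreasing T) {k : Fin N}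
    (h : ∀ᵐ u : Cube N, fiberLaw S k u = fiberLaw T k u) : ∀ᵐ u : Cube N, S u k = T u k := by
  have hset : MeasurableSet {u : Cube N | S u k = T u k} :=
    measurableSet_eq_fun ((measurable_pi_apply k).comp hS) ((measurable_pi_apply k).comp hT)
  rw [← (measurePreserving_update k).map_eq,
    ae_map_iff (measurable_update_pair k).aemeasurable hset]
  refine (Measure.ae_prod_iff_ae_ae (measurable_update_pair k hset)).2 ?_
  filter_upwards [h] with u hu
  exact ae_eq_of_monotone_of_map_eq (hSi.monotone_update k u) (hTi.monotone_update k u)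
    (measurable_fiber_apply hS k u) (measurable_fiber_apply hT k u) hu

/-- Induction on `k`: once the preceding components agree, both fibre laws are the conditional law
of the same measure at the same point, and monotone fibres with equal laws agree almost everywhere.
-/
theorem ae_eq_of_map_eq {S T : Cube N → Fin N → ℝ} (hS : Measurable S) (hT : Measurable T)
    (hSt : IsTriangular S) (hTt : IsTriangular T) (hSi : IsIncreasing S) (hTi : IsIncreasing T)
    (hSc : IsConsistent S) (hTc : IsConsistent T)
    (h : (volume : Measure (Cube N)).map S = volume.map T) : S =ᵐ[volume] T := by
  have hprob : IsProbabilityMeasure ((volume : Measure (Cube N)).map T) :=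
    Measure.isProbabilityMeasure_map hT.aemeasurable
  have key : ∀ k : Fin N, ∀ᵐ u : Cube N, S u k = T u k := by
    intro k
    induction k using WellFoundedLT.induction with
    | ind k ih =>
      have ih' : ∀ᵐ u : Cube N, ∀ i, i < k → S u i = T u i :=
        ae_all_iff.2 fun i => by
          by_cases hi : i < k
          · filter_upwards [ih i hi] with u hu _ using hu
          · exact Eventually.of_forall fun u h => absurd h hi
      refine ae_eq_of_fiberLaw_ae_eq hS hT hSi hTi ?_
      filter_upwards [ih', condLaw_ae_eq_fiberLaw hS hSt hSc _ h k,
        condLaw_ae_eq_fiberLaw hT hTt hTc _ rfl k] with u h1 h2 h3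
      rw [← h2, ← h3, initial_eq_iff.2 h1]
  filter_upwards [ae_all_iff.2 key] with u hu using funext hu

end

section

variable {N : ℕ} {p : ℝ≥0}

/-! ### Quantile functions -/

/-- The quantile function of a probability measure on the line. -/
noncomputable def quantile (m : Measure ℝ) (s : Set.Ioo (0 : ℝ) 1) : ℝ :=
  sInf {x | (s : ℝ) ≤ cdf m x}

/-- Since `0 < s < 1`, the limits `0` and `1` of the distribution function make the defining set
bounded below and nonempty. Right continuity makes its infimum a member. -/
theorem quantile_le_iff (m : Measure ℝ) (s : Set.Ioo (0 : ℝ) 1) (x : ℝ) :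
    quantile m s ≤ x ↔ (s : ℝ) ≤ cdf m x := by
  obtain ⟨b, hb⟩ := (((tendsto_cdf_atBot m).eventually (gt_mem_nhds s.2.1)).and
    (eventually_le_atBot 0)).exists
  have hbdd : BddBelow {x | (s : ℝ) ≤ cdf m x} := by
    refine ⟨b, fun y hy => le_of_not_gt fun hlt => ?_⟩
    exact absurd (hy.trans (monotone_cdf m hlt.le)) (not_le.2 hb.1)
  obtain ⟨a, ha⟩ := ((tendsto_cdf_atTop m).eventually (lt_mem_nhds s.2.2)).exists
  have hne : {x | (s : ℝ) ≤ cdf m x}.Nonempty := ⟨a, ha.le⟩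
  refine ⟨fun h => ?_, fun h => csInf_le hbdd h⟩
  refine le_trans ?_ (monotone_cdf m h)
  have hcont : Tendsto (cdf m) (𝓝[>] quantile m s) (𝓝 (cdf m (quantile m s))) :=
    (((cdf m).right_continuous _).mono Set.Ioi_subset_Ici_self).tendsto
  refine ge_of_tendsto hcont ?_
  filter_upwards [self_mem_nhdsWithin] with y hy
  obtain ⟨z, hz, hzy⟩ := exists_lt_of_csInf_lt hne hy
  exact le_trans hz (monotone_cdf m hzy.le)

theorem monotone_quantile (m : Measure ℝ) : Monotone (quantile m) := fun s t hst =>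
  (quantile_le_iff m s _).2 (le_trans hst ((quantile_le_iff m t _).1 le_rfl))

theorem measurable_quantile_kernel {α : Type*} [MeasurableSpace α] (κ : Kernel α ℝ)
    [IsMarkovKernel κ] :
    Measurable fun z : α × Set.Ioo (0 : ℝ) 1 => quantile (κ z.1) z.2 := by
  refine measurable_of_Iic fun x => ?_
  have : (fun z : α × Set.Ioo (0 : ℝ) 1 => quantile (κ z.1) z.2) ⁻¹' Set.Iic x =
      {z | (z.2 : ℝ) ≤ (κ z.1 (Set.Iic x)).toReal} := by
    ext z
    simp only [Set.mem_preimage, Set.mem_Iic, quantile_le_iff, cdf_eq_real, Set.mem_ofPred_eq]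
    rfl
  rw [this]
  exact measurableSet_le (measurable_subtype_coe.comp measurable_snd)
    ((Kernel.measurable_coe κ measurableSet_Iic).comp measurable_fst).ennreal_toReal

theorem measurable_quantile (m : Measure ℝ) [IsProbabilityMeasure m] :
    Measurable (quantile m) :=
  (measurable_quantile_kernel (Kernel.const Unit m)).comp
    (measurable_const.prodMk measurable_id (f := fun _ => ()))

theorem volume_Ioo_setOf_le {c : ℝ} (h1 : c ≤ 1) :
    volume {s : Set.Ioo (0 : ℝ) 1 | (s : ℝ) ≤ c} = ENNReal.ofReal c := by
  have : (volume : Measure (Set.Ioo (0 : ℝ) 1)) {s | (s : ℝ) ≤ c} =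
      (volume : Measure ℝ) (Subtype.val '' {s : Set.Ioo (0 : ℝ) 1 | (s : ℝ) ≤ c}) :=
    comap_subtype_coe_apply measurableSet_Ioo volume _
  rw [this]
  refine le_antisymm ?_ ?_
  · refine (measure_mono (t := Set.Ioc 0 c) ?_).trans (by simp)
    rintro _ ⟨s, hs, rfl⟩
    exact ⟨s.2.1, hs⟩
  · refine le_trans (by simp) (measure_mono (s := Set.Ioo 0 c) ?_)
    intro s hs
    exact ⟨⟨s, hs.1, hs.2.trans_le h1⟩, hs.2.le, rfl⟩

theorem map_quantile (m : Measure ℝ) [IsProbabilityMeasure m] :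
    (volume : Measure (Set.Ioo (0 : ℝ) 1)).map (quantile m) = m := by
  have : IsProbabilityMeasure ((volume : Measure (Set.Ioo (0 : ℝ) 1)).map (quantile m)) :=
    Measure.isProbabilityMeasure_map (measurable_quantile m).aemeasurable
  refine Measure.ext_of_Iic _ _ fun x => ?_
  rw [Measure.map_apply (measurable_quantile m) measurableSet_Iic, ← ofReal_cdf,
    ← volume_Ioo_setOf_le (cdf_le_one m x)]
  congr 1
  ext s
  exact quantile_le_iff m s x

/-! ### The quantile process of a law -/

/-- The quantile process of `μ`: its `k`-th component is the conditional quantile function of the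
`k`-th coordinate given the preceding components. -/
noncomputable def quantileProcess (μ : Measure (Fin N → ℝ)) [IsFiniteMeasure μ] (u : Cube N)
    (k : Fin N) : ℝ :=
  quantile (condLaw μ k fun i : Fin k => quantileProcess μ u (Fin.castLE k.is_lt.le i)) (u k)
termination_by k.val
decreasing_by exact i.2

section

variable (μ : Measure (Fin N → ℝ)) [IsFiniteMeasure μ]

theorem quantileProcess_apply (u : Cube N) (k : Fin N) :
    quantileProcess μ u k = quantile (condLaw μ k (initial k (quantileProcess μ u))) (u k) := by
  rw [quantileProcess]
  rfl

theorem measurable_quantileProcess : Measurable (quantileProcess μ) := by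
  refine measurable_pi_iff.2 fun k => ?_
  induction k using WellFoundedLT.induction with
  | ind k ih =>
    simp only [quantileProcess_apply]
    have : Measurable fun u : Cube N => initial k (quantileProcess μ u) :=
      measurable_pi_iff.2 fun i => ih _ (by simp [Fin.lt_def])
    exact (measurable_quantile_kernel (condLaw μ k)).comp (this.prodMk (measurable_pi_apply k))

theorem isTriangular_quantileProcess : IsTriangular (quantileProcess μ) := by
  intro k u v h
  induction k using WellFoundedLT.induction with
  | ind k ih =>
    rw [quantileProcess_apply, quantileProcess_apply, h k le_rfl,
      initial_eq_iff.2 fun i hi => ih i hi fun j hj => h j (hj.trans hi.le)]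

theorem isIncreasing_quantileProcess : IsIncreasing (quantileProcess μ) := by
  intro k u s hs
  rw [quantileProcess_apply, quantileProcess_apply,
    (isTriangular_quantileProcess μ).initial_update, Function.update_self]
  exact monotone_quantile _ hs

/-- Component `m` sees the point only through the preceding components and `u m`. A change of `u k`
that does not alter component `k` therefore never propagates. -/
theorem isConsistent_quantileProcess : IsConsistent (quantileProcess μ) := by
  intro k m hkm u s _ h
  induction m using WellFoundedLT.induction with
  | ind m ih =>
    rcases hkm.lt_or_eq with hlt | rfl
    · have : initial m (quantileProcess μ u) =
          initial m (quantileProcess μ (Function.update u k s)) := by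
        refine initial_eq_iff.2 fun i hi => ?_
        rcases lt_or_ge i k with hik | hik
        · rw [(isTriangular_quantileProcess μ).update hik]
        · exact ih i hi hik
      rw [quantileProcess_apply, this, quantileProcess_apply μ (Function.update u k s),
        Function.update_of_ne hlt.ne']
    · exact h

/-- After resampling the `k`-th variable the preceding components stay fixed, while component `k` is
a conditional quantile function at a fresh uniform variable; its law is the conditional law by
`map_quantile`. -/
theorem map_initial_prod_quantileProcess (k : Fin N) :
    (volume : Measure (Cube N)).map
      (fun u => (initial k (quantileProcess μ u), quantileProcess μ u k)) =
    (volume.map fun u => initial k (quantileProcess μ u)) ⊗ₘ condLaw μ k := by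
  have hX : Measurable fun u : Cube N => initial k (quantileProcess μ u) :=
    (measurable_initial k).comp (measurable_quantileProcess μ)
  have hY : Measurable fun u : Cube N => quantileProcess μ u k :=
    (measurable_pi_apply k).comp (measurable_quantileProcess μ)
  ext S hS
  have hS' : MeasurableSet ((fun u : Cube N =>
      (initial k (quantileProcess μ u), quantileProcess μ u k)) ⁻¹' S) := (hX.prodMk hY) hS
  rw [Measure.map_apply (hX.prodMk hY) hS, Measure.compProd_apply hS,
    lintegral_map (Kernel.measurable_kernel_prodMk_left hS) hX,
    ← (measurePreserving_update k).measure_preimage hS'.nullMeasurableSet,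
    Measure.prod_apply (measurable_update_pair k hS')]
  refine lintegral_congr fun u => ?_
  conv_rhs => rw [← map_quantile (condLaw μ k (initial k (quantileProcess μ u)))]
  rw [Measure.map_apply (measurable_quantile _) (measurable_prodMk_left hS)]
  congr 1
  ext s
  simp only [Set.mem_preimage]
  rw [(isTriangular_quantileProcess μ).initial_update, quantileProcess_apply,
    (isTriangular_quantileProcess μ).initial_update, Function.update_self]

end

theorem measurable_snoc (j : ℕ) :
    Measurable fun z : (Fin j → ℝ) × ℝ => (Fin.snoc z.1 z.2 : Fin (j + 1) → ℝ) := by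
  refine measurable_pi_iff.2 fun i => ?_
  induction i using Fin.lastCases with
  | last => simpa using measurable_snd
  | cast i =>
    simp only [Fin.snoc_castSucc]
    exact (measurable_pi_apply i).comp measurable_fst

/-- Induction on the number `j` of coordinates: on both sides the law of the first `j + 1`
coordinates is that of the first `j`, composed with the same conditional law. For `j = 0` the space
is a point. -/
theorem map_quantileProcess (μ : Measure (Fin N → ℝ)) [IsProbabilityMeasure μ] :
    (volume : Measure (Cube N)).map (quantileProcess μ) = μ := by
  have hT := measurable_quantileProcess μ
  have hpre : ∀ (j : ℕ) (hj : j ≤ N),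
      Measurable fun (x : Fin N → ℝ) (i : Fin j) => x (Fin.castLE hj i) := fun j hj =>
    measurable_pi_iff.2 fun _ => measurable_pi_apply _
  have key : ∀ (j : ℕ) (hj : j ≤ N),
      (volume : Measure (Cube N)).map (fun u (i : Fin j) => quantileProcess μ u (Fin.castLE hj i)) =
      μ.map fun x (i : Fin j) => x (Fin.castLE hj i) := by
    intro j
    induction j with
    | zero =>
      intro hj
      have h1 : IsProbabilityMeasure ((volume : Measure (Cube N)).map
          (fun u (i : Fin 0) => quantileProcess μ u (Fin.castLE hj i))) :=
        Measure.isProbabilityMeasure_map ((hpre 0 hj).comp hT).aemeasurable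
      have h2 : IsProbabilityMeasure (μ.map fun x (i : Fin 0) => x (Fin.castLE hj i)) :=
        Measure.isProbabilityMeasure_map (hpre 0 hj).aemeasurable
      ext s _
      rcases s.eq_empty_or_nonempty with rfl | hs
      · simp
      · rw [Subsingleton.eq_univ_of_nonempty hs, measure_univ, measure_univ]
    | succ j ih =>
      intro hj
      let k : Fin N := ⟨j, hj⟩
      have hk : Measurable fun x : Fin N → ℝ => (initial k x, x k) :=
        (measurable_initial k).prodMk (measurable_pi_apply k)
      have hsplit : (fun (x : Fin N → ℝ) (i : Fin (j + 1)) => x (Fin.castLE hj i)) =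
          (fun z : (Fin j → ℝ) × ℝ => (Fin.snoc z.1 z.2 : Fin (j + 1) → ℝ)) ∘
            fun x => (initial k x, x k) := by
        funext x i
        induction i using Fin.lastCases with
        | last => simp only [Fin.snoc_last, Function.comp_apply]; rfl
        | cast i => simp only [Fin.snoc_castSucc, Function.comp_apply]; rfl
      have h1 := map_initial_prod_quantileProcess μ k
      have h2 : ((volume : Measure (Cube N)).map fun u => initial k (quantileProcess μ u)) =
          μ.map (initial k) := ih (Nat.le_of_succ_le hj)
      rw [h2, compProd_condLaw] at h1
      rw [hsplit, ← Measure.map_map (measurable_snoc j) hk, ← h1]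
      refine Eq.trans ?_ (Measure.map_map (measurable_snoc j) (hk.comp hT)).symm
      exact congrArg (fun f => Measure.map f volume)
        (funext fun u => congrFun hsplit (quantileProcess μ u))
  have := key N le_rfl
  simpa using this

end

section

variable {N : ℕ} {p : ℝ≥0}

/-! ### Convergence in `L_p` -/

theorem integrable_min_norm_one {α : Type*} [MeasurableSpace α] {ρ : Measure α}
    [IsFiniteMeasure ρ] {g : α → Fin N → ℝ} (hg : AEStronglyMeasurable g ρ) :
    Integrable (fun a => min ‖WithLp.toLp 2 (g a)‖ (1 : ℝ)) ρ := by
  refine Integrable.of_bound (C := 1) ((aestronglyMeasurable_toLp hg 2).norm.inf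
    aestronglyMeasurable_const) (Eventually.of_forall fun a => ?_)
  rw [Real.norm_of_nonneg (le_min (norm_nonneg _) zero_le_one)]
  exact min_le_right _ _

theorem tendsto_zero_of_tendsto_min_one {ι : Type*} {l : Filter ι} {a : ι → ℝ}
    (h : Tendsto (fun i => min (a i) 1) l (𝓝 0)) : Tendsto a l (𝓝 0) := by
  refine h.congr' ?_
  filter_upwards [h.eventually (gt_mem_nhds one_pos)] with i hi
  exact min_eq_left ((min_lt_iff.1 hi).resolve_right (lt_irrefl _)).le

/-- A sequence that converges to `0` in `L_p` has a subsequence that converges to `0` almost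
everywhere. -/
theorem exists_seq_tendsto_ae_of_pSize (hp : p = 0 ∨ 1 ≤ p) {f : ℕ → Cube N → Fin N → ℝ}
    (hf : ∀ n, MemLp (f n) p volume) (h : Tendsto (fun n => pSize p volume (f n)) atTop (𝓝 0)) :
    ∃ ns : ℕ → ℕ, StrictMono ns ∧ ∀ᵐ u, Tendsto (fun i => f (ns i) u) atTop (𝓝 0) := by
  rcases hp with rfl | hp
  · simp only [pSize, if_true] at h
    have hint := fun n => integrable_min_norm_one (hf n).1
    have h1 : Tendsto (fun n => eLpNorm ((fun u => min ‖WithLp.toLp 2 (f n u)‖ (1 : ℝ)) - 0) 1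
        (volume : Measure (Cube N))) atTop (𝓝 0) := by
      have : ∀ n, eLpNorm ((fun u => min ‖WithLp.toLp 2 (f n u)‖ (1 : ℝ)) - 0) 1
          (volume : Measure (Cube N)) =
          ENNReal.ofReal (∫ u, min ‖WithLp.toLp 2 (f n u)‖ (1 : ℝ)) := by
        intro n
        rw [sub_zero, eLpNorm_one_eq_lintegral_enorm, ← ofReal_integral_norm_eq_lintegral_enorm
          (hint n)]
        congr 1
        exact integral_congr_ae (Eventually.of_forall fun u =>
          Real.norm_of_nonneg (le_min (norm_nonneg _) zero_le_one))
      simp only [this]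
      simpa using ENNReal.tendsto_ofReal h
    obtain ⟨ns, hns, hae⟩ := (tendstoInMeasure_of_tendsto_eLpNorm one_ne_zero
      (fun n => (hint n).1) (aestronglyMeasurable_zero) h1).exists_seq_tendsto_ae
    refine ⟨ns, hns, ?_⟩
    filter_upwards [hae] with u hu
    have h2 := tendsto_zero_iff_norm_tendsto_zero.2 (tendsto_zero_of_tendsto_min_one hu)
    simpa [Function.comp_def] using ((PiLp.continuous_ofLp 2 (fun _ : Fin N => ℝ)).tendsto _).comp h2
  · have : Fact (1 ≤ (p : ℝ≥0∞)) := ⟨by exact_mod_cast hp⟩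
    have h0 : (p : ℝ≥0∞) ≠ 0 := (zero_lt_one.trans_le this.out).ne'
    have h1 : Tendsto (fun n => eLpNorm ((fun u => WithLp.toLp (p : ℝ≥0∞) (f n u)) - 0) p
        (volume : Measure (Cube N))) atTop (𝓝 0) := by
      simp only [pSize_eq_eLpNorm hp (hf _)] at h
      simp only [sub_zero]
      exact (ENNReal.tendsto_toReal_zero_iff fun n => (memLp_toLp (hf n)).2.ne).1 h
    obtain ⟨ns, hns, hae⟩ := (tendstoInMeasure_of_tendsto_eLpNorm h0
      (fun n => (memLp_toLp (hf n)).1) (aestronglyMeasurable_zero) h1).exists_seq_tendsto_ae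
    refine ⟨ns, hns, ?_⟩
    filter_upwards [hae] with u hu
    simpa [Function.comp_def] using ((PiLp.continuous_ofLp (p : ℝ≥0∞) (fun _ : Fin N => ℝ)).tendsto _).comp hu

theorem tendsto_pSize_zero_exponent {f : ℕ → Cube N → Fin N → ℝ}
    (hf : ∀ n, AEStronglyMeasurable (f n) volume)
    (h : ∀ᵐ u, Tendsto (fun i => f i u) atTop (𝓝 0)) :
    Tendsto (fun n => pSize 0 volume (f n)) atTop (𝓝 0) := by
  simp only [pSize, if_true]
  have := tendsto_integral_of_dominated_convergence (μ := (volume : Measure (Cube N)))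
    (F := fun n u => min ‖WithLp.toLp 2 (f n u)‖ (1 : ℝ)) (f := fun _ => 0) (fun _ => 1)
    (fun n => (integrable_min_norm_one (hf n)).1) (integrable_const _)
    (fun n => Eventually.of_forall fun u => by
      rw [Real.norm_of_nonneg (le_min (norm_nonneg _) zero_le_one)]
      exact min_le_right _ _) (by
      filter_upwards [h] with u hu
      have h1 := (((PiLp.continuous_toLp 2 (fun _ : Fin N => ℝ)).tendsto _).comp hu).norm.min
        (tendsto_const_nhds (x := (1 : ℝ)))
      simpa using h1)
  simpa using this

theorem pSize_smul (hp : 1 ≤ p) {α : Type*} [MeasurableSpace α] (ρ : Measure α) (c : ℝ)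
    (g : α → Fin N → ℝ) : pSize p ρ (fun a => c • g a) = |c| * pSize p ρ g := by
  have h0 : p ≠ 0 := (zero_lt_one.trans_le hp).ne'
  have h0' : (p : ℝ) ≠ 0 := by exact_mod_cast h0
  simp only [pSize, if_neg h0, Pi.smul_apply, smul_eq_mul, abs_mul,
    Real.mul_rpow (abs_nonneg _) (abs_nonneg _), ← Finset.mul_sum, integral_const_mul]
  rw [Real.mul_rpow (by positivity) (integral_nonneg fun a => by positivity),
    ← Real.rpow_mul (abs_nonneg _), mul_one_div_cancel h0', Real.rpow_one]

/-- The truncated increments have summable integrals, so almost everywhere they are summable. Their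
terms are then eventually below `1`, where truncation does nothing, so the increments themselves are
summable. -/
theorem ae_tendsto_of_dist_lt_geometric {f : ℕ → Cube N → Fin N → ℝ}
    (hf : ∀ n, AEStronglyMeasurable (f n) volume)
    (h : ∀ n, pSize 0 volume (fun u => f n u - f (n + 1) u) < (1 / 2) ^ n) :
    ∀ᵐ u, ∃ l, Tendsto (fun n => f n u) atTop (𝓝 l) := by
  set w : ℕ → Cube N → ℝ := fun n u => min ‖WithLp.toLp 2 (f n u - f (n + 1) u)‖ 1
  have hw0 : ∀ n u, 0 ≤ w n u := fun n u => le_min (norm_nonneg _) zero_le_one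
  have hwi : ∀ n, Integrable (w n) volume := fun n =>
    integrable_min_norm_one ((hf n).sub (hf (n + 1)))
  have hfin : ∫⁻ u : Cube N, ∑' n, ENNReal.ofReal (w n u) ≠ ∞ := by
    rw [lintegral_tsum fun n => (hwi n).1.aemeasurable.ennreal_ofReal]
    have hle : ∀ n, ∫⁻ u : Cube N, ENNReal.ofReal (w n u) ≤ ENNReal.ofReal ((1 / 2) ^ n) := by
      intro n
      rw [← ofReal_integral_eq_lintegral_ofReal (hwi n) (Eventually.of_forall (hw0 n))]
      exact ENNReal.ofReal_le_ofReal (by simpa only [pSize, if_true] using (h n).le)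
    refine ne_top_of_le_ne_top ?_ (ENNReal.tsum_le_tsum hle)
    rw [← ENNReal.ofReal_tsum_of_nonneg (fun n => by positivity) summable_geometric_two]
    exact ENNReal.ofReal_ne_top
  have hae := ae_lt_top' (AEMeasurable.tsum
    fun n => (hwi n).1.aemeasurable.ennreal_ofReal) hfin
  filter_upwards [hae] with u hu
  have hs : Summable fun n => w n u := by
    simpa [ENNReal.toReal_ofReal (hw0 _ u)] using ENNReal.summable_toReal hu.ne
  have hlt := hs.tendsto_atTop_zero.eventually (gt_mem_nhds one_pos)
  have hs' : Summable fun n => dist (WithLp.toLp 2 (f n u)) (WithLp.toLp 2 (f (n + 1) u)) := by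
    refine Summable.of_norm_bounded_eventually_nat hs ?_
    filter_upwards [hlt] with n hn
    rw [Real.norm_of_nonneg dist_nonneg, dist_eq_norm, ← WithLp.toLp_sub]
    exact le_min le_rfl ((min_lt_iff.1 hn).resolve_right (lt_irrefl _)).le
  obtain ⟨l, hl⟩ := cauchySeq_tendsto_of_complete (cauchySeq_of_summable_dist hs')
  exact ⟨_, ((PiLp.continuous_ofLp 2 (fun _ : Fin N => ℝ)).tendsto _).comp hl⟩

/-- The class of a `p`-integrable function. -/
noncomputable def toLpCube (f : Cube N → Fin N → ℝ) (hf : MemLp f p volume) : LpCube N p :=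
  ⟨AEEqFun.mk f hf.1, (memLp_congr_ae (AEEqFun.coeFn_mk f hf.1)).2 hf⟩

theorem coeFn_toLpCube (f : Cube N → Fin N → ℝ) (hf : MemLp f p volume) :
    (toLpCube f hf : Cube N →ₘ[volume] (Fin N → ℝ)) =ᵐ[volume] f :=
  AEEqFun.coeFn_mk f hf.1

theorem memLp_coeFn (f : LpCube N p) :
    MemLp (f : Cube N →ₘ[volume] (Fin N → ℝ)) p volume := f.2

variable [hp : Fact (p = 0 ∨ 1 ≤ p)]

theorem dist_eq_pSize (f g : LpCube N p) : dist f g = pSize p volume (fun u =>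
    (f : Cube N →ₘ[volume] (Fin N → ℝ)) u - (g : Cube N →ₘ[volume] (Fin N → ℝ)) u) := rfl

theorem tendsto_toLpCube {f : ℕ → LpCube N p} {g : Cube N → Fin N → ℝ} (hg : MemLp g p volume)
    (h : Tendsto (fun n => pSize p volume
      (fun u => (f n : Cube N →ₘ[volume] (Fin N → ℝ)) u - g u)) atTop (𝓝 0)) :
    Tendsto f atTop (𝓝 (toLpCube g hg)) := by
  rw [tendsto_iff_dist_tendsto_zero]
  refine h.congr fun n => ?_
  rw [dist_eq_pSize]
  refine pSize_congr ?_
  filter_upwards [coeFn_toLpCube g hg] with u hu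
  rw [hu]

theorem completeSpace_LpCube_of_dist_lt_geometric
    (H : ∀ f : ℕ → LpCube N p, (∀ M n m, M ≤ n → M ≤ m → dist (f n) (f m) < (1 / 2) ^ M) →
      ∃ g : Cube N → Fin N → ℝ, MemLp g p volume ∧ Tendsto (fun n => pSize p volume
        (fun u => (f n : Cube N →ₘ[volume] (Fin N → ℝ)) u - g u)) atTop (𝓝 0)) :
    CompleteSpace (LpCube N p) := by
  refine Metric.complete_of_convergent_controlled_sequences (fun n => (1 / 2) ^ n)
    (fun n => by positivity) fun f hf => ?_
  obtain ⟨g, hg, h⟩ := H f hf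
  exact ⟨_, tendsto_toLpCube hg h⟩

/-- For `p = 0` a rapidly Cauchy sequence converges almost everywhere, and dominated convergence
gives the limit in the metric. For `p ≥ 1` the metric is the `L^p` distance for the `ℓ^p` norm on
`ℝ^N`, and completeness is the classical one. -/
instance completeSpace_LpCube : CompleteSpace (LpCube N p) := by
  refine completeSpace_LpCube_of_dist_lt_geometric fun f hf => ?_
  have hsub : ∀ n m, MemLp (fun u => (f n : Cube N →ₘ[volume] (Fin N → ℝ)) u -
      (f m : Cube N →ₘ[volume] (Fin N → ℝ)) u) p volume := fun n m =>
    (memLp_coeFn (f n)).sub (memLp_coeFn (f m))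
  rcases hp.out with rfl | hp1
  · obtain ⟨g, hg, hlim⟩ := exists_stronglyMeasurable_limit_of_tendsto_ae
      (fun n => (memLp_coeFn (f n)).1)
      (ae_tendsto_of_dist_lt_geometric (fun n => (memLp_coeFn (f n)).1)
        fun n => hf n n (n + 1) le_rfl n.le_succ)
    refine ⟨g, memLp_zero_iff_aestronglyMeasurable.2 hg.aestronglyMeasurable,
      tendsto_pSize_zero_exponent
        (fun n => (memLp_coeFn (f n)).1.sub hg.aestronglyMeasurable) ?_⟩
    filter_upwards [hlim] with u hu
    simpa using hu.sub_const (g u)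
  · have : Fact (1 ≤ (p : ℝ≥0∞)) := ⟨by exact_mod_cast hp1⟩
    obtain ⟨g, hg, hlim⟩ := Lp.cauchy_complete_eLpNorm (E := PiLp p fun _ : Fin N => ℝ)
      (μ := (volume : Measure (Cube N))) this.out
      (f := fun n u => WithLp.toLp (p : ℝ≥0∞) ((f n : Cube N →ₘ[volume] (Fin N → ℝ)) u))
      (fun n => memLp_toLp (memLp_coeFn (f n))) (B := fun n => ENNReal.ofReal ((1 / 2) ^ n))
      (by
        rw [← ENNReal.ofReal_tsum_of_nonneg (fun n => by positivity) summable_geometric_two]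
        exact ENNReal.ofReal_ne_top)
      (by
        intro M n m hn hm
        have h1 := hf M n m hn hm
        rw [dist_eq_pSize, pSize_eq_eLpNorm hp1 (hsub n m)] at h1
        exact (ENNReal.lt_ofReal_iff_toReal_lt (memLp_toLp (hsub n m)).2.ne).2 h1)
    have hg' : MemLp (fun u => WithLp.ofLp (g u)) p volume :=
      ((PiLp.continuousLinearEquiv p ℝ
        (fun _ : Fin N => ℝ)).toContinuousLinearMap).comp_memLp' hg
    refine ⟨_, hg', ?_⟩
    have : ∀ n, pSize p volume (fun u =>
        (f n : Cube N →ₘ[volume] (Fin N → ℝ)) u - WithLp.ofLp (g u)) =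
        (eLpNorm ((fun u => WithLp.toLp (p : ℝ≥0∞)
          ((f n : Cube N →ₘ[volume] (Fin N → ℝ)) u)) - g) p volume).toReal := fun n =>
      pSize_eq_eLpNorm hp1 ((memLp_coeFn (f n)).sub hg')
    simp only [this]
    simpa [Function.comp_def] using (ENNReal.tendsto_toReal ENNReal.zero_ne_top).comp hlim

end

section

variable {N : ℕ} {p : ℝ≥0}

/-! ### The increasing triangular transformations form a closed set -/

theorem volume_Icc_pos {a b : Set.Ioo (0 : ℝ) 1} (h : a < b) : 0 < volume (Set.Icc a b) := by
  have : (volume : Measure (Set.Ioo (0 : ℝ) 1)) (Set.Icc a b) =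
      (volume : Measure ℝ) (Subtype.val '' Set.Icc a b) :=
    comap_subtype_coe_apply measurableSet_Ioo volume _
  rw [this]
  refine lt_of_lt_of_le ?_ (measure_mono (s := Set.Ioo (a : ℝ) b) ?_)
  · simpa using h
  · intro s hs
    exact ⟨⟨s, a.2.1.trans hs.1, hs.2.trans b.2.2⟩, ⟨hs.1.le, hs.2.le⟩, rfl⟩

theorem exists_mem_Icc_of_ae {P : Set.Ioo (0 : ℝ) 1 → Prop} (hP : ∀ᵐ s, P s)
    {a b : Set.Ioo (0 : ℝ) 1} (h : a < b) : ∃ s ∈ Set.Icc a b, P s := by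
  by_contra! hne
  exact (volume_Icc_pos h).ne' (measure_mono_null hne (ae_iff.1 hP))

/-- A dense sequence in the unit interval. -/
noncomputable def grid (n : ℕ) : Set.Ioo (0 : ℝ) 1 :=
  haveI : Nonempty (Set.Ioo (0 : ℝ) 1) := (Set.nonempty_Ioo.2 one_pos).to_subtype
  TopologicalSpace.denseSeq (Set.Ioo (0 : ℝ) 1) n

theorem exists_grid_between {a b : Set.Ioo (0 : ℝ) 1} (h : a < b) :
    ∃ n, a < grid n ∧ grid n < b := by
  have : Nonempty (Set.Ioo (0 : ℝ) 1) := ⟨a⟩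
  obtain ⟨_, ⟨n, rfl⟩, h1, h2⟩ :=
    (TopologicalSpace.denseRange_denseSeq (Set.Ioo (0 : ℝ) 1)).exists_between h
  exact ⟨n, h1, h2⟩

theorem measurable_update_apply {T : Cube N → Fin N → ℝ} (hT : Measurable T) (k : Fin N)
    (s : Set.Ioo (0 : ℝ) 1) : Measurable fun u => T (Function.update u k s) k :=
  (measurable_fiber hT k).comp (measurable_id.prodMk measurable_const)

/-- Along each fibre in the `k`-th direction, the `k`-th components are pointwise bounded. -/
def FiberBounded (T : ℕ → Cube N → Fin N → ℝ) (k : Fin N) (u : Cube N) : Prop :=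
  ∀ j, ∃ C : ℕ, ∀ n, |T n (Function.update u k (grid j)) k| ≤ C

/-- The upper limit of a sequence of transformations, where it is finite. -/
noncomputable def upperLimit (T : ℕ → Cube N → Fin N → ℝ) (u : Cube N) (k : Fin N) : ℝ :=
  -- The test overwrites `u k`, so its answer is constant along the fibre. Hence the default `0`
  -- spoils neither monotonicity nor, for triangular `T n`, triangularity.
  open Classical in if FiberBounded T k u then limsup (fun n => T n u k) atTop else 0

section

variable {T : ℕ → Cube N → Fin N → ℝ}

theorem measurable_upperLimit (hT : ∀ n, Measurable (T n)) : Measurable (upperLimit T) := by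
  refine measurable_pi_iff.2 fun k => ?_
  refine Measurable.ite ?_ (Measurable.limsup fun n => (measurable_pi_apply k).comp (hT n))
    measurable_const
  refine measurableSet_setOfPred.2 (Measurable.forall fun j => Measurable.exists fun C =>
    Measurable.forall fun n => measurableSet_setOfPred.1 ?_)
  exact measurableSet_le (measurable_update_apply (hT n) k _).abs measurable_const

theorem update_congr {k : Fin N} {u v : Cube N} (h : ∀ i ≤ k, u i = v i)
    (s : Set.Ioo (0 : ℝ) 1) : ∀ i ≤ k, Function.update u k s i = Function.update v k s i := by
  intro i hi
  by_cases hik : i = k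
  · subst hik; simp
  · simp [hik, h i hi]

theorem isTriangular_upperLimit (hT : ∀ n, IsTriangular (T n)) : IsTriangular (upperLimit T) := by
  intro k u v h
  have h1 : FiberBounded T k u ↔ FiberBounded T k v := by
    unfold FiberBounded
    simp only [fun n j => hT n k _ _ (update_congr h (grid j))]
  have h2 : ∀ n, T n u k = T n v k := fun n => hT n k u v h
  by_cases h3 : FiberBounded T k v <;> simp [upperLimit, h1, h2, h3]

theorem FiberBounded.exists_bound (hT : ∀ n, IsIncreasing (T n)) {k : Fin N} {u : Cube N}
    (h : FiberBounded T k u) : ∃ C : ℝ, ∀ n, |T n u k| ≤ C := by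
  obtain ⟨a, ha⟩ := exists_lt (u k)
  obtain ⟨b, hb⟩ := exists_gt (u k)
  obtain ⟨i, -, hi⟩ := exists_grid_between ha
  obtain ⟨j, hj, -⟩ := exists_grid_between hb
  obtain ⟨C, hC⟩ := h i
  obtain ⟨D, hD⟩ := h j
  refine ⟨max C D, fun n => abs_le.2 ⟨?_, ?_⟩⟩
  · have h1 := (hT n).monotone_update k u hi.le
    simp only [Function.update_eq_self] at h1
    have := (abs_le.1 (hC n)).1
    linarith [le_max_left (C : ℝ) D]
  · have h1 := (hT n).monotone_update k u hj.le
    simp only [Function.update_eq_self] at h1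
    have := (abs_le.1 (hD n)).2
    linarith [le_max_right (C : ℝ) D]

theorem isIncreasing_upperLimit (hT : ∀ n, IsIncreasing (T n)) :
    IsIncreasing (upperLimit T) := by
  intro k u s hs
  have h1 : FiberBounded T k (Function.update u k s) ↔ FiberBounded T k u := by
    simp [FiberBounded]
  by_cases h : FiberBounded T k u
  · simp only [upperLimit, h1, h, if_true]
    obtain ⟨C, hC⟩ := h.exists_bound hT
    obtain ⟨D, hD⟩ := (h1.2 h).exists_bound hT
    refine limsup_le_limsup (Eventually.of_forall fun n => hT n k u s hs) ?_ ?_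
    · exact (isBoundedUnder_of ⟨-C, fun n => (abs_le.1 (hC n)).1⟩ :
        IsBoundedUnder (· ≥ ·) atTop fun n => T n u k).isCoboundedUnder_le
    · exact isBoundedUnder_of ⟨D, fun n => (abs_le.1 (hD n)).2⟩
  · simp [upperLimit, h1, h]

/-- Convergent sequences are bounded, so by Fubini almost every fibre has bounds at almost all its
points, in particular at points on either side of any grid point. Monotonicity carries these bounds
to the grid point. -/
theorem ae_fiberBounded (hT : ∀ n, IsIncreasing (T n)) {f : Cube N → Fin N → ℝ}
    (h : ∀ᵐ u, Tendsto (fun n => T n u) atTop (𝓝 (f u))) (k : Fin N) :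
    ∀ᵐ u, FiberBounded T k u := by
  have h1 : ∀ᵐ u : Cube N, ∃ C : ℕ, ∀ n, |T n u k| ≤ C := by
    filter_upwards [h] with u hu
    obtain ⟨C, hC⟩ := (tendsto_pi_nhds.1 hu k).norm.bddAbove_range
    obtain ⟨M, hM⟩ := exists_nat_ge C
    exact ⟨M, fun n => (hC ⟨n, rfl⟩).trans hM⟩
  have h2 := Measure.ae_ae_of_ae_prod ((measurePreserving_update k).quasiMeasurePreserving.ae h1)
  filter_upwards [h2] with u hu j
  obtain ⟨a, ha⟩ := exists_lt (grid j)
  obtain ⟨b, hb⟩ := exists_gt (grid j)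
  obtain ⟨s, hs, C, hC⟩ := exists_mem_Icc_of_ae hu ha
  obtain ⟨t, ht, D, hD⟩ := exists_mem_Icc_of_ae hu hb
  refine ⟨max C D, fun n => ?_⟩
  push_cast
  refine abs_le.2 ⟨?_, ?_⟩
  · have := (hT n).monotone_update k u hs.2
    have := (abs_le.1 (hC n)).1
    simp only at *
    linarith [le_max_left (C : ℝ) D]
  · have := (hT n).monotone_update k u ht.1
    have := (abs_le.1 (hD n)).2
    simp only at *
    linarith [le_max_right (C : ℝ) D]

theorem upperLimit_ae_eq (hT : ∀ n, IsIncreasing (T n)) {f : Cube N → Fin N → ℝ}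
    (h : ∀ᵐ u, Tendsto (fun n => T n u) atTop (𝓝 (f u))) : f =ᵐ[volume] upperLimit T := by
  filter_upwards [h, ae_all_iff.2 fun k => ae_fiberBounded hT h k] with u hu hb
  funext k
  simp only [upperLimit, hb k, if_true]
  exact (tendsto_pi_nhds.1 hu k).limsup_eq.symm

end

section

variable [hp : Fact (p = 0 ∨ 1 ≤ p)]

/-- A subsequence of representatives converges almost everywhere. Its upper limit is still defined,
increasing and triangular at every point, as membership demands of a representative. -/
theorem isClosed_IT : IsClosed (IT N p) := by
  refine isClosed_of_closure_subset fun f hf => ?_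
  obtain ⟨x, hx, hlim⟩ := mem_closure_iff_seq_limit.1 hf
  rw [tendsto_iff_dist_tendsto_zero] at hlim
  simp only [dist_eq_pSize] at hlim
  obtain ⟨ns, -, hae⟩ := exists_seq_tendsto_ae_of_pSize hp.out
    (fun n => (memLp_coeFn (x n)).sub (memLp_coeFn f)) hlim
  choose T hTm hTt hTi hTx using hx
  refine ⟨upperLimit fun i => T (ns i), measurable_upperLimit fun i => hTm _,
    isTriangular_upperLimit fun i => hTt _, isIncreasing_upperLimit fun i => hTi _,
    upperLimit_ae_eq (fun i => hTi _) ?_⟩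
  filter_upwards [hae, ae_all_iff.2 hTx] with u hu hxu
  have := hu.add_const ((f : Cube N →ₘ[volume] (Fin N → ℝ)) u)
  simpa [hxu] using this

end

/-! ### Cones -/

theorem coeFn_add_LpCube (f g : LpCube N p) :
    ((f + g : LpCube N p) : Cube N →ₘ[volume] (Fin N → ℝ)) =ᵐ[volume]
      fun u => (f : Cube N →ₘ[volume] (Fin N → ℝ)) u + (g : Cube N →ₘ[volume] (Fin N → ℝ)) u :=
  AEEqFun.coeFn_add _ _

theorem coeFn_smul_LpCube (c : ℝ) (f : LpCube N p) :
    ((c • f : LpCube N p) : Cube N →ₘ[volume] (Fin N → ℝ)) =ᵐ[volume]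
      fun u => c • (f : Cube N →ₘ[volume] (Fin N → ℝ)) u :=
  AEEqFun.coeFn_smul _ _

theorem add_ae_eq {f g : LpCube N p} {S T : Cube N → Fin N → ℝ}
    (hf : (f : Cube N →ₘ[volume] (Fin N → ℝ)) =ᵐ[volume] S)
    (hg : (g : Cube N →ₘ[volume] (Fin N → ℝ)) =ᵐ[volume] T) :
    ((f + g : LpCube N p) : Cube N →ₘ[volume] (Fin N → ℝ)) =ᵐ[volume] S + T := by
  filter_upwards [coeFn_add_LpCube f g, hf, hg] with u h1 h2 h3
  rw [h1, h2, h3, Pi.add_apply]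

theorem smul_ae_eq (c : ℝ) {f : LpCube N p} {S : Cube N → Fin N → ℝ}
    (hf : (f : Cube N →ₘ[volume] (Fin N → ℝ)) =ᵐ[volume] S) :
    ((c • f : LpCube N p) : Cube N →ₘ[volume] (Fin N → ℝ)) =ᵐ[volume] c • S := by
  filter_upwards [coeFn_smul_LpCube c f, hf] with u h1 h2
  rw [h1, h2, Pi.smul_apply]

section

variable {S T : Cube N → Fin N → ℝ}

theorem IsTriangular.add (hS : IsTriangular S) (hT : IsTriangular T) : IsTriangular (S + T) :=
  fun k u v h => congrArg₂ (· + ·) (hS k u v h) (hT k u v h)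

theorem IsTriangular.smul (hS : IsTriangular S) (c : ℝ) : IsTriangular (c • S) :=
  fun k u v h => congrArg (c * ·) (hS k u v h)

theorem IsIncreasing.add (hS : IsIncreasing S) (hT : IsIncreasing T) : IsIncreasing (S + T) :=
  fun k u s h => add_le_add (hS k u s h) (hT k u s h)

theorem IsIncreasing.smul (hS : IsIncreasing S) {c : ℝ} (hc : 0 < c) : IsIncreasing (c • S) :=
  fun k u s h => mul_le_mul_of_nonneg_left (hS k u s h) hc.le

theorem IsIncreasing.add_strictly (hS : IsIncreasing S) (hT : IsStrictlyIncreasing T) :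
    IsStrictlyIncreasing (S + T) :=
  fun k u s h => add_lt_add_of_le_of_lt (hS k u s h.le) (hT k u s h)

theorem IsStrictlyIncreasing.smul (hS : IsStrictlyIncreasing S) {c : ℝ} (hc : 0 < c) :
    IsStrictlyIncreasing (c • S) :=
  fun k u s h => mul_lt_mul_of_pos_left (hS k u s h) hc

/-- Both increments are nonnegative, so if their sum vanishes each of them vanishes. Without
monotonicity they could cancel. -/
theorem IsConsistent.add (hS : IsConsistent S) (hT : IsConsistent T) (hSi : IsIncreasing S)
    (hTi : IsIncreasing T) : IsConsistent (S + T) := by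
  intro k m hkm u s hs h
  simp only [Pi.add_apply] at h ⊢
  have h1 := hSi k u s hs
  have h2 := hTi k u s hs
  rw [hS k m hkm u s hs (by linarith), hT k m hkm u s hs (by linarith)]

theorem IsConsistent.smul (hS : IsConsistent S) {c : ℝ} (hc : 0 < c) : IsConsistent (c • S) := by
  intro k m hkm u s hs h
  simp only [Pi.smul_apply, smul_eq_mul] at h ⊢
  rw [hS k m hkm u s hs (mul_left_cancel₀ hc.ne' h)]

end

/-- The convex cone of increasing triangular transformations. -/
def coneIT (N : ℕ) (p : ℝ≥0) : ConvexCone ℝ (LpCube N p) where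
  carrier := IT N p
  smul_mem' := by
    rintro c hc f ⟨S, hS, hSt, hSi, hf⟩
    exact ⟨c • S, hS.const_smul c, hSt.smul c, hSi.smul hc, smul_ae_eq c hf⟩
  add_mem' := by
    rintro f ⟨S, hS, hSt, hSi, hf⟩ g ⟨T, hT, hTt, hTi, hg⟩
    exact ⟨S + T, hS.add hT, hSt.add hTt, hSi.add hTi, add_ae_eq hf hg⟩

/-- The convex cone of strictly increasing triangular transformations. -/
def coneSIT (N : ℕ) (p : ℝ≥0) : ConvexCone ℝ (LpCube N p) where
  carrier := SIT N p
  smul_mem' := by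
    rintro c hc f ⟨S, hS, hSt, hSi, hf⟩
    exact ⟨c • S, hS.const_smul c, hSt.smul c, hSi.smul hc, smul_ae_eq c hf⟩
  add_mem' := by
    rintro f ⟨S, hS, hSt, hSi, hf⟩ g ⟨T, hT, hTt, hTi, hg⟩
    exact ⟨S + T, hS.add hT, hSt.add hTt, hSi.isIncreasing.add_strictly hTi, add_ae_eq hf hg⟩

/-- The convex cone of quantile processes. -/
def coneQuantile (N : ℕ) (p : ℝ≥0) : ConvexCone ℝ (LpCube N p) where
  carrier := quantileSet N p
  smul_mem' := by
    rintro c hc f ⟨S, hS, hSt, hSi, hSc, hf⟩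
    exact ⟨c • S, hS.const_smul c, hSt.smul c, hSi.smul hc, hSc.smul hc, smul_ae_eq c hf⟩
  add_mem' := by
    rintro f ⟨S, hS, hSt, hSi, hSc, hf⟩ g ⟨T, hT, hTt, hTi, hTc, hg⟩
    exact ⟨S + T, hS.add hT, hSt.add hTt, hSi.add hTi, hSc.add hTc hSi hTi, add_ae_eq hf hg⟩

theorem SIT_subset_quantileSet : SIT N p ⊆ quantileSet N p := by
  rintro f ⟨T, hT, hTt, hTs, hf⟩
  exact ⟨T, hT, hTt, hTs.isIncreasing, hTs.isConsistent, hf⟩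

theorem quantileSet_subset_IT : quantileSet N p ⊆ IT N p := by
  rintro f ⟨T, hT, hTt, hTi, -, hf⟩
  exact ⟨T, hT, hTt, hTi, hf⟩

/-! ### Density of the strictly increasing transformations -/

/-- The identity of the cube, as a transformation. -/
def inclusion (u : Cube N) (k : Fin N) : ℝ := u k

theorem measurable_inclusion : Measurable (inclusion (N := N)) :=
  measurable_pi_iff.2 fun k => measurable_subtype_coe.comp (measurable_pi_apply k)

theorem isTriangular_inclusion : IsTriangular (inclusion (N := N)) :=
  fun k _ _ h => congrArg Subtype.val (h k le_rfl)

theorem isStrictlyIncreasing_inclusion : IsStrictlyIncreasing (inclusion (N := N)) := by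
  intro k u s h
  simpa [inclusion] using h

theorem memLp_inclusion : MemLp (inclusion (N := N)) p volume := by
  refine MemLp.of_bound measurable_inclusion.aestronglyMeasurable 1
    (Eventually.of_forall fun u => (pi_norm_le_iff_of_nonneg zero_le_one).2 fun k => ?_)
  rw [inclusion, Real.norm_of_nonneg (u k).2.1.le]
  exact (u k).2.2.le

theorem tendsto_pSize_smul (hp : p = 0 ∨ 1 ≤ p) {g : Cube N → Fin N → ℝ} (hg : MemLp g p volume)
    {c : ℕ → ℝ} (hc : Tendsto c atTop (𝓝 0)) :
    Tendsto (fun n => pSize p volume (fun u => c n • g u)) atTop (𝓝 0) := by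
  rcases hp with rfl | hp
  · refine tendsto_pSize_zero_exponent (fun n => hg.1.const_smul (c n))
      (Eventually.of_forall fun u => ?_)
    simpa using hc.smul_const (g u)
  · simp only [pSize_smul hp]
    simpa using hc.abs.mul_const (pSize p volume g)

variable [hp : Fact (p = 0 ∨ 1 ≤ p)]

/-- The approximants are `f` plus the identity of the cube scaled by `1 / (n + 1)`. This one density
statement serves both the closure of the quantile processes and the density of the strictly
increasing maps in them. -/
theorem IT_subset_closure_SIT : IT N p ⊆ closure (SIT N p) := by
  rintro f ⟨T, hT, hTt, hTi, hf⟩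
  let g : LpCube N p := toLpCube inclusion memLp_inclusion
  let c : ℕ → ℝ := fun n => 1 / ((n : ℝ) + 1)
  have hc : Tendsto c atTop (𝓝 0) := tendsto_one_div_add_atTop_nhds_zero_nat
  refine mem_closure_iff_seq_limit.2 ⟨fun n => f + c n • g, fun n => ?_, ?_⟩
  · have hcn : 0 < c n := by positivity
    exact ⟨T + c n • inclusion, hT.add (measurable_inclusion.const_smul _),
      hTt.add (isTriangular_inclusion.smul _),
      hTi.add_strictly (isStrictlyIncreasing_inclusion.smul hcn),
      add_ae_eq hf (smul_ae_eq _ (coeFn_toLpCube _ _))⟩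
  · rw [tendsto_iff_dist_tendsto_zero]
    refine (tendsto_pSize_smul hp.out (memLp_coeFn g) hc).congr fun n => ?_
    rw [dist_eq_pSize]
    refine pSize_congr ?_
    filter_upwards [coeFn_add_LpCube f (c n • g), coeFn_smul_LpCube (c n) g] with u h1 h2
    rw [h1, h2, add_sub_cancel_left]

theorem closure_quantileSet : closure (quantileSet N p) = IT N p :=
  (closure_minimal quantileSet_subset_IT isClosed_IT).antisymm
    (IT_subset_closure_SIT.trans (closure_mono SIT_subset_quantileSet))

end

section

variable {N : ℕ} {p : ℝ≥0}

/-! ### Existence and uniqueness of the quantile process -/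

theorem law_meas {f : LpCube N p} {T : Cube N → Fin N → ℝ}
    (hf : (f : Cube N →ₘ[volume] (Fin N → ℝ)) =ᵐ[volume] T) :
    (law f).meas = (volume : Measure (Cube N)).map T :=
  Measure.map_congr hf

theorem quantileSet_injOn_law : Set.InjOn law (quantileSet N p) := by
  rintro f ⟨S, hS, hSt, hSi, hSc, hf⟩ g ⟨T, hT, hTt, hTi, hTc, hg⟩ h
  refine Subtype.ext (AEEqFun.ext (hf.trans (EventuallyEq.trans ?_ hg.symm)))
  refine ae_eq_of_map_eq hS hT hSt hTt hSi hTi hSc hTc ?_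
  rw [← law_meas hf, ← law_meas hg, h]

theorem exists_mem_quantileSet_law_eq (μ : Prob N p) : ∃ f ∈ quantileSet N p, law f = μ := by
  have := μ.isProb
  have hT := measurable_quantileProcess μ.meas
  have hmem : MemLp (quantileProcess μ.meas) p volume := by
    have h := μ.memLp
    rw [← map_quantileProcess μ.meas] at h
    exact h.comp_of_map hT.aemeasurable
  refine ⟨toLpCube _ hmem, ⟨_, hT, isTriangular_quantileProcess _,
    isIncreasing_quantileProcess _, isConsistent_quantileProcess _, coeFn_toLpCube _ _⟩, ?_⟩
  exact Prob.ext ((law_meas (coeFn_toLpCube _ _)).trans (map_quantileProcess μ.meas))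

theorem Q_spec (μ : Prob N p) : Q μ ∈ quantileSet N p ∧ law (Q μ) = μ := by
  have h := exists_mem_quantileSet_law_eq μ
  rw [Q, dif_pos h]
  exact h.choose_spec

theorem Q_law {f : LpCube N p} (hf : f ∈ quantileSet N p) : Q (law f) = f :=
  quantileSet_injOn_law (Q_spec _).1 hf (Q_spec _).2

/-! ### Triangular regular laws -/

theorem TriangularRegular_iff (μ : Prob N p) [IsFiniteMeasure μ.meas] :
    TriangularRegular μ ↔ ∀ k : Fin N, ∀ᵐ x ∂μ.meas, ∀ t : ℝ,
      condLaw μ.meas k (initial k x) {t} = 0 := Iff.rfl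

instance nullSingletonClass_Ioo :
    NullSingletonClass (volume : Measure (Set.Ioo (0 : ℝ) 1)) where
  measure_singleton s := by
    rw [show (volume : Measure (Set.Ioo (0 : ℝ) 1)) {s} =
      (volume : Measure ℝ) (Subtype.val '' {s}) from
        comap_subtype_coe_apply measurableSet_Ioo volume _]
    simp

/-- An injective function has level sets of at most one point, which are null. A monotone function
that is not strictly monotone is constant on a nondegenerate interval, which produces an atom. -/
theorem strictMono_iff_map_singleton {g : Set.Ioo (0 : ℝ) 1 → ℝ} (hg : Monotone g)
    (hm : Measurable g) : StrictMono g ↔ ∀ t, (volume.map g) {t} = 0 := by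
  simp only [Measure.map_apply hm (measurableSet_singleton _)]
  constructor
  · intro h t
    exact (Set.subsingleton_singleton.preimage h.injective).measure_zero _
  · intro h a b hab
    refine (hg hab.le).lt_of_ne fun heq => (volume_Icc_pos hab).ne' ?_
    exact measure_mono_null (fun s hs => le_antisymm ((hg hs.2).trans heq.ge) (hg hs.1)) (h (g a))

theorem strictMono_iff_grid {g : Set.Ioo (0 : ℝ) 1 → ℝ} (hg : Monotone g) :
    StrictMono g ↔ ∀ i j, grid i < grid j → g (grid i) < g (grid j) := by
  refine ⟨fun h i j hij => h hij, fun h a b hab => ?_⟩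
  obtain ⟨j, hj, hjb⟩ := exists_grid_between hab
  obtain ⟨i, hi, hij⟩ := exists_grid_between hj
  exact (hg hi.le).trans_lt ((h i j hij).trans_le (hg hjb.le))

theorem measurableSet_strictMono {α : Type*} [MeasurableSpace α] {g : α → Set.Ioo (0 : ℝ) 1 → ℝ}
    (hg : ∀ a, Monotone (g a)) (hm : ∀ s, Measurable fun a => g a s) :
    MeasurableSet {a | StrictMono (g a)} := by
  simp only [strictMono_iff_grid (hg _)]
  refine measurableSet_setOfPred.2 (Measurable.forall fun i => Measurable.forall fun j =>
    Measurable.imp measurable_const (measurableSet_setOfPred.1 ?_))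
  exact measurableSet_lt (hm _) (hm _)

/-- The quantifier over `t` is uncountable. Through quantile functions the condition becomes strict
monotonicity, which can be tested on the countable grid. -/
theorem measurableSet_forall_kernel_singleton {α : Type*} [MeasurableSpace α] (κ : Kernel α ℝ)
    [IsMarkovKernel κ] : MeasurableSet {a | ∀ t, κ a {t} = 0} := by
  have h : ∀ a, (∀ t, κ a {t} = 0) ↔ StrictMono (quantile (κ a)) := fun a => by
    rw [strictMono_iff_map_singleton (monotone_quantile _) (measurable_quantile _), map_quantile]
  simp only [h]
  exact measurableSet_strictMono (fun a => monotone_quantile (κ a)) fun s =>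
    (measurable_quantile_kernel κ).comp (measurable_id.prodMk measurable_const)

/-- The transformation `T`, with its `k`-th component replaced by the `k`-th variable wherever it
fails to be strictly increasing in that variable. -/
noncomputable def strictify (T : Cube N → Fin N → ℝ) (u : Cube N) (k : Fin N) : ℝ :=
  open Classical in
    if StrictMono fun s : Set.Ioo (0 : ℝ) 1 => T (Function.update u k s) k then T u k else u k

section

variable {T : Cube N → Fin N → ℝ}

theorem measurable_strictify (hT : Measurable T) (hTi : IsIncreasing T) :
    Measurable (strictify T) :=
  measurable_pi_iff.2 fun k => Measurable.ite
    (measurableSet_strictMono (hTi.monotone_update k) (measurable_update_apply hT k))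
    ((measurable_pi_apply k).comp hT) (measurable_subtype_coe.comp (measurable_pi_apply k))

theorem isTriangular_strictify (hT : IsTriangular T) : IsTriangular (strictify T) := by
  intro k u v h
  have h1 : ∀ s, T (Function.update u k s) k = T (Function.update v k s) k := fun s =>
    hT k _ _ (update_congr h s)
  have h2 : StrictMono (fun s => T (Function.update u k s) k) ↔
      StrictMono fun s => T (Function.update v k s) k := by simp only [h1]
  by_cases h3 : StrictMono fun s => T (Function.update v k s) k <;>
    simp [strictify, h2, h3, hT k u v h, h k le_rfl]

/-- The test has the same answer along a whole fibre, so there the component is either a strictly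
monotone fibre of `T` or the identity. -/
theorem isStrictlyIncreasing_strictify (T : Cube N → Fin N → ℝ) :
    IsStrictlyIncreasing (strictify T) := by
  intro k u s hs
  by_cases h : StrictMono fun s : Set.Ioo (0 : ℝ) 1 => T (Function.update u k s) k
  · simp only [strictify, Function.update_idem, h, if_true]
    simpa using h hs
  · simpa [strictify, h] using hs

theorem strictify_ae_eq
    (h : ∀ k : Fin N, ∀ᵐ u : Cube N,
      StrictMono fun s : Set.Ioo (0 : ℝ) 1 => T (Function.update u k s) k) :
    T =ᵐ[volume] strictify T := by
  filter_upwards [ae_all_iff.2 h] with u hu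
  funext k
  exact (if_pos (hu k)).symm

end

/-- Conditional laws are fibre laws, and these are atomless exactly when the fibres are strictly
increasing. From regularity this is known only for almost every fibre, and `strictify` repairs the
others. -/
theorem triangularRegular_iff_Q_mem_SIT (μ : Prob N p) : TriangularRegular μ ↔ Q μ ∈ SIT N p := by
  have := μ.isProb
  rw [TriangularRegular_iff]
  constructor
  · intro h
    obtain ⟨⟨T, hT, hTt, hTi, hTc, hf⟩, hlaw⟩ := Q_spec μ
    have hmap : (volume : Measure (Cube N)).map T = μ.meas := by rw [← law_meas hf, hlaw]
    refine ⟨strictify T, measurable_strictify hT hTi, isTriangular_strictify hTt,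
      isStrictlyIncreasing_strictify T, hf.trans (strictify_ae_eq fun k => ?_)⟩
    -- The equality `hmap` is used on the filters `ae` only, since `condLaw` also depends on
    -- `μ.meas` and should stay as it is.
    filter_upwards [ae_of_ae_map hT.aemeasurable ((hmap ▸ ae_mono le_rfl :
        ae (volume.map T) ≤ ae μ.meas) (h k)),
      condLaw_ae_eq_fiberLaw hT hTt hTc μ.meas hmap k] with u h1 h2
    refine (strictMono_iff_map_singleton (hTi.monotone_update k u)
      (measurable_fiber_apply hT k u)).2 fun t => ?_
    exact (congrArg (fun m : Measure ℝ => m {t}) h2).symm.trans (h1 t)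
  · rintro ⟨T, hT, hTt, hTs, hf⟩ k
    have hmap : (volume : Measure (Cube N)).map T = μ.meas := by
      rw [← law_meas hf, (Q_spec μ).2]
    have hset : MeasurableSet {x | ∀ t, condLaw μ.meas k (initial k x) {t} = 0} :=
      measurable_initial k (measurableSet_forall_kernel_singleton (condLaw μ.meas k))
    have h1 : ∀ᵐ u : Cube N, ∀ t, condLaw μ.meas k (initial k (T u)) {t} = 0 := by
      filter_upwards [condLaw_ae_eq_fiberLaw hT hTt hTs.isConsistent μ.meas hmap k] with u hu
      rw [hu]
      exact (strictMono_iff_map_singleton (hTs.isIncreasing.monotone_update k u)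
        (measurable_fiber_apply hT k u)).1 (hTs.strictMono_update k u)
    have h2 := (ae_map_iff hT.aemeasurable hset).2 h1
    exact (hmap ▸ ae_mono le_rfl : ae μ.meas ≤ ae (volume.map T)) h2

/-! ### The completion -/

theorem range_Q : Set.range (Q : Prob N p → LpCube N p) = quantileSet N p := by
  refine Set.Subset.antisymm ?_ fun f hf => ⟨law f, Q_law hf⟩
  rintro _ ⟨μ, rfl⟩
  exact (Q_spec μ).1

section

variable [hp : Fact (p = 0 ∨ 1 ≤ p)]

theorem isometry_Q : Isometry (Q : Prob N p → LpCube N p) :=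
  Isometry.of_dist_eq fun μ ν => (krDist_eq_dist μ ν).symm

open UniformSpace in
-- An isometric image of a complete space is closed, so the range contains the closure of the
-- quantile processes. Conversely, the preimage of the closed set `IT N p` contains the dense set of
-- laws.
theorem range_extension_Q :
    Set.range (Completion.extension (Q : Prob N p → LpCube N p)) = IT N p := by
  have hiso : Isometry (Completion.extension (Q : Prob N p → LpCube N p)) :=
    isometry_Q.completion_extension
  have hcoe : ∀ μ : Prob N p, Completion.extension Q (μ : Completion (Prob N p)) = Q μ :=
    Completion.extension_coe isometry_Q.uniformContinuous
  refine Set.Subset.antisymm ?_ ?_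
  · rintro _ ⟨x, rfl⟩
    induction x using Completion.induction_on with
    | hp => exact isClosed_IT.preimage hiso.continuous
    | ih μ =>
      rw [hcoe]
      exact quantileSet_subset_IT (Q_spec μ).1
  · rw [← closure_quantileSet, ← range_Q]
    refine closure_minimal ?_ hiso.isClosedEmbedding.isClosed_range
    rintro _ ⟨μ, rfl⟩
    exact ⟨μ, hcoe μ⟩

open UniformSpace in
theorem exists_isometryEquiv_completion :
    ∃ e : Completion (Prob N p) ≃ᵢ IT N p, ∀ μ : Prob N p, (e μ : LpCube N p) = Q μ := by
  have hiso : Isometry (Completion.extension (Q : Prob N p → LpCube N p)) :=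
    isometry_Q.completion_extension
  have hmem : ∀ x, Completion.extension (Q : Prob N p → LpCube N p) x ∈ IT N p := fun x => by
    rw [← range_extension_Q]
    exact ⟨x, rfl⟩
  have hsurj : ∀ y : IT N p, ∃ x, Completion.extension (Q : Prob N p → LpCube N p) x = y :=
    fun y => range_extension_Q.ge y.2
  choose g hg using hsurj
  refine ⟨IsometryEquiv.mk' (fun x => ⟨_, hmem x⟩) g (fun y => Subtype.ext (hg y))
    fun x y => hiso x y, fun μ => ?_⟩
  exact Completion.extension_coe isometry_Q.uniformContinuous μ

end

end

end KnotheRosenblatt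

open KnotheRosenblatt
theorem theorem1p7 (N : ℕ) (p : ℝ≥0) [Fact (p = 0 ∨ 1 ≤ p)] :
    -- every `μ` is the law of exactly one quantile process, namely of `Q μ`
    (∀ μ : Prob N p, ∃! f : LpCube N p, f ∈ quantileSet N p ∧ law f = μ) ∧
    (∀ μ : Prob N p, Q μ ∈ quantileSet N p ∧ law (Q μ) = μ) ∧
    -- the inclusions
    SIT N p ⊆ quantileSet N p ∧ quantileSet N p ⊆ IT N p ∧
    -- the three sets are convex cones
    (∃ C : ConvexCone ℝ (LpCube N p), (C : Set (LpCube N p)) = SIT N p) ∧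
    (∃ C : ConvexCone ℝ (LpCube N p), (C : Set (LpCube N p)) = quantileSet N p) ∧
    (∃ C : ConvexCone ℝ (LpCube N p), (C : Set (LpCube N p)) = IT N p) ∧
    -- the closure of the quantile processes
    closure (quantileSet N p) = IT N p ∧
    -- the completion of `P_p(ℝ^N)`, by an isometry that extends `μ ↦ Q μ`
    (∃ e : UniformSpace.Completion (Prob N p) ≃ᵢ IT N p,
      ∀ μ : Prob N p, (e μ : LpCube N p) = Q μ) ∧
    -- triangular regular measures
    (∀ μ : Prob N p, TriangularRegular μ ↔ Q μ ∈ SIT N p) ∧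
    Q '' {μ : Prob N p | TriangularRegular μ} = SIT N p ∧
    (∀ f ∈ SIT N p, Q (law f) = f) ∧
    -- `SIT N p`, a subset of `quantileSet N p`, is dense in it
    quantileSet N p ⊆ closure (SIT N p) := by
  refine ⟨fun μ => ?_, Q_spec, SIT_subset_quantileSet, quantileSet_subset_IT,
    ⟨coneSIT N p, rfl⟩, ⟨coneQuantile N p, rfl⟩, ⟨coneIT N p, rfl⟩, closure_quantileSet,
    exists_isometryEquiv_completion, triangularRegular_iff_Q_mem_SIT, ?_,
    fun f hf => Q_law (SIT_subset_quantileSet hf),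
    quantileSet_subset_IT.trans IT_subset_closure_SIT⟩
  · refine ⟨Q μ, Q_spec μ, ?_⟩
    rintro f ⟨hf, rfl⟩
    exact (Q_law hf).symm
  · refine Set.Subset.antisymm ?_ fun f hf => ?_
    · rintro _ ⟨μ, hμ, rfl⟩
      exact (triangularRegular_iff_Q_mem_SIT μ).1 hμ
    · have hQ := Q_law (SIT_subset_quantileSet hf)
      exact ⟨law f, (triangularRegular_iff_Q_mem_SIT _).2 (hQ.symm ▸ hf), hQ⟩
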